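/- Let $(\mathcal M,g)$ be a connected closed (compact, boundaryless) $C^\infty$ Riemannian manifold, and let $d_g(x,y)$ be its geodesic distance, i.e. the infimum of the lengths of $C^1$ curves joining $x$ to $y$. For $\lambda>0$ the Gaussian kernel $e^{-\lambda d_g^2(\cdot,\cdot)}$ is called positive definite if for every $N\in\mathbb N$ and all $x_1,\dots,x_N\in\mathcal M$ the Gram matrix $\big(e^{-\lambda d_g(x_i,x_j)^2}\big)_{1\le i,j\le N}$ is positive semidefinite. Let $$\Lambda_+(\mathcal M,g):=\{\lambda>0 : e^{-\lambda d_g^2(\cdot,\cdot)}\text{ is positive definite on }\mathcal M\}.$$ Then $\Lambda_+(\mathcal M,g)=\emptyset$ in each of the following cases: 1. $\mathcal M$ is not simply connected (and $g$ is any smooth Riemannian metric on $\mathcal M$); 2. $(\mathcal M,g)$ is the unit sphere $\mathbf S^n\subset\mathbb R^{n+1}$ with its round metric (the metric induced by the Euclidean one), $n\ge 2$; 3. $(\mathcal M,g)$ is the real Grassmannian $\mathbf{Gr}(k,n)$ of $k$-dimensional linear subspaces of $\mathbb R^n$, $1\le k<n$, with its canonical metric, given on $T_W\mathbf{Gr}(k,n)=\mathrm{Hom}(W,W^\perp)$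 by $\langle X,Y\rangle=\operatorname{tr}(X^{\top}Y)$. -/

import Mathlib

open Manifold
open scoped Bundle ContDiff InnerProductSpace

universe u v

section PullbackMetric
variable {E : Type*} [NormedAddCommGroup E] [NormedSpace ℝ E]
  {H : Type*} [TopologicalSpace H] {I : ModelWithCorners ℝ E H}
  {M : Type*} [TopologicalSpace M] [ChartedSpace H M]
  {F : Type*} [NormedAddCommGroup F] [InnerProductSpace ℝ F]

/-- The pullback of the inner product of `F` to the tangent space at `x` along `f : M → F`:
`(v, w) ↦ ⟪df_x v, df_x w⟫`. -/
noncomputable def pullbackInner (I : ModelWithCorners ℝ E H) (f : M → F) (x : M) :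
    TangentSpace I x →L[ℝ] TangentSpace I x →L[ℝ] ℝ :=
  ((mvfderiv I f x).precomp ℝ).comp ((innerSL ℝ).comp (mvfderiv I f x))

theorem pullbackInner_apply (f : M → F) (x : M) (v w : TangentSpace I x) :
    pullbackInner I f x v w = ⟪mvfderiv I f x v, mvfderiv I f x w⟫_ℝ := rfl

theorem contDiff_precomp_innerSL : ContDiff ℝ ∞ (fun T : E →L[ℝ] F ↦
    ((ContinuousLinearMap.compL ℝ E F ℝ).flip T).comp
      ((innerSL ℝ (E := F) : F →L[ℝ] F →L[ℝ] ℝ).comp T)) := by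
  fun_prop

theorem isVonNBounded_pullbackInner [FiniteDimensional ℝ E] {f : M → F} {x : M}
    (hinj : Function.Injective (mvfderiv I f x)) :
    Bornology.IsVonNBounded ℝ {v : TangentSpace I x | pullbackInner I f x v v < 1} := by
  let D : E →L[ℝ] F := mvfderiv I f x
  obtain ⟨K, -, hK⟩ := D.toLinearMap.exists_antilipschitzWith (LinearMap.ker_eq_bot.2 hinj)
  change Bornology.IsVonNBounded ℝ {v : E | ⟪D v, D v⟫_ℝ < 1}
  refine (NormedSpace.isVonNBounded_ball ℝ E (K + 1)).subset ?_
  intro v hv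
  rw [Set.mem_ofPred_eq, real_inner_self_eq_norm_sq] at hv
  have h1 : ‖D v‖ < 1 := by nlinarith [norm_nonneg (D v)]
  have h2 : ‖v‖ ≤ K * ‖D v‖ := by simpa using hK.le_mul_dist v 0
  rw [mem_ball_zero_iff]
  nlinarith [K.coe_nonneg]

variable [IsManifold I ∞ M]

theorem contMDiff_pullbackInner {f : M → F} (hf : ContMDiff I 𝓘(ℝ, F) ∞ f) :
    ContMDiff I (I.prod 𝓘(ℝ, E →L[ℝ] E →L[ℝ] ℝ)) ∞
      (fun x ↦ Bundle.TotalSpace.mk' (E →L[ℝ] E →L[ℝ] ℝ)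
        (E := fun x : M ↦ TangentSpace I x →L[ℝ] TangentSpace I x →L[ℝ] ℝ) x
        (pullbackInner I f x)) := by
  intro x₀
  rw [Bundle.contMDiffAt_section]
  have h := (hf x₀).mfderiv_const (m := ∞) (by simp)
  set T : M → E →L[ℝ] F :=
    inTangentCoordinates I 𝓘(ℝ, F) id f (mfderiv I 𝓘(ℝ, F) f) x₀ with hT
  have key := contDiff_precomp_innerSL.contMDiff.contMDiffAt.comp x₀ h
  refine key.congr_of_eventuallyEq ?_
  filter_upwards [(chartAt H x₀).open_source.mem_nhds (mem_chart_source H x₀)] with x hx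
  ext v w
  rw [hom_trivializationAt_apply,
    inCoordinates_apply_eq₂ (by simpa using hx) (by simpa using hx) (by simp)]
  simp only [pullbackInner_apply]
  have hTv (v : E) : T x v =
      mvfderiv I f x ((trivializationAt E (TangentSpace I) x₀).symm x v) := by
    simp only [hT, inTangentCoordinates, ContinuousLinearMap.inCoordinates]
    simp only [id_eq, mvfderiv]
    rw [TangentBundle.continuousLinearMapAt_model_space]
    change mfderiv I 𝓘(ℝ, F) f x
      (Bundle.Trivialization.symmL ℝ (trivializationAt E (TangentSpace I) x₀) x v) = _
    rw [Bundle.Trivialization.symmL_apply _ (by simpa using hx)]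
    rfl
  simp [hTv]

/-- The Riemannian metric induced on `M` by a smooth immersion `f` into an inner product space. -/
noncomputable def pullbackMetric [FiniteDimensional ℝ E] (f : M → F) (hf : ContMDiff I 𝓘(ℝ, F) ∞ f)
    (hinj : ∀ x, Function.Injective (mvfderiv I f x)) :
    Bundle.ContMDiffRiemannianMetric I ∞ E (fun x : M ↦ TangentSpace I x) where
  inner x := pullbackInner I f x
  symm x v w := real_inner_comm _ _
  pos x v hv := by
    rw [pullbackInner_apply]
    exact real_inner_self_pos.2 fun h ↦ hv (hinj x (h.trans (map_zero _).symm))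
  isVonNBounded x := isVonNBounded_pullbackInner (hinj x)
  contMDiff := contMDiff_pullbackInner hf

/-- The geodesic distance of the Riemannian metric `g`: the infimum of the `g`-lengths of the
`C^1` paths from `x` to `y` (a finite number whenever `M` is connected). -/
noncomputable def riemannianDist
    (g : Bundle.ContMDiffRiemannianMetric I ∞ E (fun x : M ↦ TangentSpace I x))
    (x y : M) : ℝ :=
  letI : Bundle.RiemannianBundle (fun x : M ↦ TangentSpace I x) := ⟨g.toRiemannianMetric⟩
  (riemannianEDist I x y).toReal

/-- A real kernel on `X` is positive definite if all its Gram matrices are positive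
semidefinite. -/
def IsPositiveDefiniteKernel {X : Type*} (κ : X → X → ℝ) : Prop :=
  ∀ (N : ℕ) (x : Fin N → X), (Matrix.of fun i j ↦ κ (x i) (x j)).PosSemidef

/-- The set of parameters `lam > 0` for which the Gaussian kernel `exp (-lam * d_g(x, y) ^ 2)` of
the Riemannian metric `g` is positive definite. -/
def gaussianRange
    (g : Bundle.ContMDiffRiemannianMetric I ∞ E (fun x : M ↦ TangentSpace I x)) : Set ℝ :=
  {lam | 0 < lam ∧
    IsPositiveDefiniteKernel fun x y : M ↦ Real.exp (-lam * riemannianDist g x y ^ 2)}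

end PullbackMetric

/-- The round metric on the unit sphere of `ℝ^(n+1)`, induced by the inclusion. -/
noncomputable def roundMetric (n : ℕ) :
    Bundle.ContMDiffRiemannianMetric (𝓡 n) ∞ (EuclideanSpace ℝ (Fin n))
    (fun x : Metric.sphere (0 : EuclideanSpace ℝ (Fin (n + 1))) 1 ↦ TangentSpace (𝓡 n) x) :=
  haveI : Fact (Module.finrank ℝ (EuclideanSpace ℝ (Fin (n + 1))) = n + 1) := ⟨by simp⟩
  pullbackMetric (fun x ↦ (x : EuclideanSpace ℝ (Fin (n + 1)))) contMDiff_coe_sphere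
    injective_mvfderiv_subtypeVal_sphere


/-- The real Grassmannian `Gr(k, n)` of `k`-dimensional linear subspaces of `ℝ^n`. -/
def RealGrassmannian (k n : ℕ) : Type :=
  {W : Submodule ℝ (EuclideanSpace ℝ (Fin n)) // Module.finrank ℝ W = k}

namespace RealGrassmannian

open ContinuousLinearMap

section LinearAlgebra

variable {K V : Type*} [NormedAddCommGroup K] [InnerProductSpace ℝ K] [FiniteDimensional ℝ K]
  [NormedAddCommGroup V] [InnerProductSpace ℝ V]

theorem contDiff_adjoint_real [FiniteDimensional ℝ V] [CompleteSpace K] [CompleteSpace V] :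
    ContDiff ℝ ∞ (fun A : K →L[ℝ] V ↦ adjoint A) := by
  let f : (K →L[ℝ] V) →ₗ[ℝ] (V →L[ℝ] K) :=
    { toFun := fun A ↦ adjoint A
      map_add' := fun A B ↦ map_add _ A B
      map_smul' := fun c A ↦ by simp }
  exact (LinearMap.toContinuousLinearMap f).contDiff

theorem isUnit_of_inj (T : K →L[ℝ] K) (h : ∀ u, T u = 0 → u = 0) : IsUnit T := by
  rw [ContinuousLinearMap.isUnit_iff_bijective]
  have h1 : Function.Injective T.toLinearMap := (injective_iff_map_eq_zero _).2 h
  exact ⟨h1, LinearMap.injective_iff_surjective.1 h1⟩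

variable [CompleteSpace K] [CompleteSpace V]

theorem starProjection_range_eq (A : K →L[ℝ] V) (hA : IsUnit (A.adjoint ∘L A)) :
    A.range.starProjection = A ∘L Ring.inverse (A.adjoint ∘L A) ∘L A.adjoint := by
  ext v
  refine Submodule.eq_starProjection_of_mem_of_inner_eq_zero ⟨_, rfl⟩ ?_
  rintro _ ⟨u, rfl⟩
  have h : A.adjoint (A (Ring.inverse (A.adjoint ∘L A) (A.adjoint v))) = A.adjoint v :=
    congrArg (fun T : K →L[ℝ] K ↦ T (A.adjoint v)) (Ring.mul_inverse_cancel _ hA)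
  change ⟪v - A (Ring.inverse (A.adjoint ∘L A) (A.adjoint v)), A u⟫_ℝ = 0
  rw [← adjoint_inner_left, map_sub, h, sub_self, inner_zero_left]

end LinearAlgebra

variable {k n : ℕ}

/-- The orthogonal projection of `ℝ^n` onto the subspace `W`. -/
noncomputable def proj (W : RealGrassmannian k n) :
    EuclideanSpace ℝ (Fin n) →L[ℝ] EuclideanSpace ℝ (Fin n) :=
  W.1.starProjection

theorem proj_injective : Function.Injective (proj : RealGrassmannian k n → _) := by
  intro W W' h
  apply Subtype.ext
  rw [← Submodule.range_starProjection W.1, ← Submodule.range_starProjection W'.1]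
  exact congrArg (fun T : EuclideanSpace ℝ (Fin n) →L[ℝ] EuclideanSpace ℝ (Fin n) ↦ T.range) h

/-- The topology of `Gr(k, n)` is induced by `W ↦ P_W`, with `P_W` the orthogonal projection. -/
noncomputable instance : TopologicalSpace (RealGrassmannian k n) :=
  TopologicalSpace.induced proj inferInstance

theorem continuous_proj : Continuous (proj : RealGrassmannian k n → _) :=
  continuous_induced_dom

/-- The model space of `Gr(k, n)`: linear maps from `ℝ^k` to `ℝ^(n-k)`. -/
abbrev Model (k n : ℕ) : Type := EuclideanSpace ℝ (Fin k) →L[ℝ] EuclideanSpace ℝ (Fin (n - k))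

/-- A linear isometry from `ℝ^k` onto a given `k`-dimensional subspace `U` of `ℝ^n`. -/
noncomputable def isoFrame {k n : ℕ} (U : Submodule ℝ (EuclideanSpace ℝ (Fin n)))
    (h : Module.finrank ℝ U = k) :
    EuclideanSpace ℝ (Fin k) →ₗᵢ[ℝ] EuclideanSpace ℝ (Fin n) :=
  U.subtypeₗᵢ.comp ((stdOrthonormalBasis ℝ U).reindex (finCongr h)).repr.symm.toLinearIsometry

theorem range_isoFrame (U : Submodule ℝ (EuclideanSpace ℝ (Fin n)))
    (h : Module.finrank ℝ U = k) :
    (isoFrame U h).toContinuousLinearMap.range = U := by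
  ext v
  constructor
  · rintro ⟨u, rfl⟩
    exact Subtype.coe_prop _
  · intro hv
    refine ⟨((stdOrthonormalBasis ℝ U).reindex (finCongr h)).repr ⟨v, hv⟩, ?_⟩
    simp [isoFrame]

theorem finrank_orthogonal (W : RealGrassmannian k n) : Module.finrank ℝ W.1ᗮ = n - k := by
  have h := W.1.finrank_add_finrank_orthogonal
  rw [W.2, finrank_euclideanSpace_fin] at h
  omega

/-- A linear isometry from `ℝ^k` onto `W`. -/
noncomputable def frame (W : RealGrassmannian k n) :
    EuclideanSpace ℝ (Fin k) →L[ℝ] EuclideanSpace ℝ (Fin n) :=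
  (isoFrame W.1 W.2).toContinuousLinearMap

/-- A linear isometry from `ℝ^(n-k)` onto the orthogonal complement of `W`. -/
noncomputable def coframe (W : RealGrassmannian k n) :
    EuclideanSpace ℝ (Fin (n - k)) →L[ℝ] EuclideanSpace ℝ (Fin n) :=
  (isoFrame W.1ᗮ W.finrank_orthogonal).toContinuousLinearMap

theorem isometry_adjoint {m : ℕ} (a : EuclideanSpace ℝ (Fin m) →ₗᵢ[ℝ] EuclideanSpace ℝ (Fin n)) :
    (adjoint a.toContinuousLinearMap) ∘L a.toContinuousLinearMap = 1 := by
  ext1 u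
  refine ext_inner_right ℝ fun w ↦ ?_
  simp

variable (W₀ W : RealGrassmannian k n)

theorem frame_adjoint_frame : W₀.frame.adjoint ∘L W₀.frame = 1 := isometry_adjoint _

theorem coframe_adjoint_coframe : W₀.coframe.adjoint ∘L W₀.coframe = 1 := isometry_adjoint _

theorem frame_mem (u) : W₀.frame u ∈ W₀.1 := by
  rw [← range_isoFrame W₀.1 W₀.2]; exact ⟨u, rfl⟩

theorem coframe_mem (u) : W₀.coframe u ∈ W₀.1ᗮ := by
  rw [← range_isoFrame W₀.1ᗮ W₀.finrank_orthogonal]; exact ⟨u, rfl⟩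

theorem coframe_adjoint_frame : W₀.coframe.adjoint ∘L W₀.frame = 0 := by
  ext1 u
  refine ext_inner_right ℝ fun w ↦ ?_
  rw [comp_apply, adjoint_inner_left]
  simpa using Submodule.inner_right_of_mem_orthogonal (W₀.frame_mem u) (W₀.coframe_mem w)

theorem frame_adjoint_coframe : W₀.frame.adjoint ∘L W₀.coframe = 0 := by
  ext1 u
  refine ext_inner_right ℝ fun w ↦ ?_
  rw [comp_apply, adjoint_inner_left]
  simpa using Submodule.inner_left_of_mem_orthogonal (W₀.frame_mem w) (W₀.coframe_mem u)

theorem frame_add_coframe :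
    W₀.frame ∘L W₀.frame.adjoint + W₀.coframe ∘L W₀.coframe.adjoint = 1 := by
  have h1 := starProjection_range_eq W₀.frame (by rw [frame_adjoint_frame]; exact isUnit_one)
  have h2 := starProjection_range_eq W₀.coframe (by rw [coframe_adjoint_coframe]; exact isUnit_one)
  rw [frame_adjoint_frame, Ring.inverse_one] at h1
  rw [coframe_adjoint_coframe, Ring.inverse_one] at h2
  have e1 : W₀.frame.range = W₀.1 := range_isoFrame _ _
  have e2 : W₀.coframe.range = W₀.1ᗮ := range_isoFrame _ _
  simp only [e1] at h1
  simp only [e2] at h2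
  ext1 v
  have := W₀.1.starProjection_add_starProjection_orthogonal v
  rw [h1, h2] at this
  exact this

/-- The compression of an operator `P` to the subspace `W₀`, read in the frame of `W₀`. -/
noncomputable def compress (P : EuclideanSpace ℝ (Fin n) →L[ℝ] EuclideanSpace ℝ (Fin n)) :
    EuclideanSpace ℝ (Fin k) →L[ℝ] EuclideanSpace ℝ (Fin k) :=
  W₀.frame.adjoint ∘L P ∘L W₀.frame

/-- The slope of the range of `P`, seen as the graph of a linear map from `W₀` to its orthogonal
complement, read in the frames of these two spaces. -/
noncomputable def coord (P : EuclideanSpace ℝ (Fin n) →L[ℝ] EuclideanSpace ℝ (Fin n)) :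
    Model k n :=
  W₀.coframe.adjoint ∘L P ∘L W₀.frame ∘L Ring.inverse (W₀.compress P)

/-- The parametrization of the graph of `X` over `W₀`. -/
noncomputable def graphMap (X : Model k n) :
    EuclideanSpace ℝ (Fin k) →L[ℝ] EuclideanSpace ℝ (Fin n) :=
  W₀.frame + W₀.coframe ∘L X

theorem frame_adjoint_graphMap (X : Model k n) :
    W₀.frame.adjoint ∘L W₀.graphMap X = 1 := by
  rw [graphMap, comp_add, ← comp_assoc, frame_adjoint_coframe, frame_adjoint_frame]
  simp

theorem coframe_adjoint_graphMap (X : Model k n) :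
    W₀.coframe.adjoint ∘L W₀.graphMap X = X := by
  rw [graphMap, comp_add, ← comp_assoc, coframe_adjoint_frame, coframe_adjoint_coframe]
  ext1 u; simp

theorem graphMap_injective (X : Model k n) : Function.Injective (W₀.graphMap X) := by
  intro u v h
  have := congrArg W₀.frame.adjoint h
  have h1 (w) : W₀.frame.adjoint (W₀.graphMap X w) = w :=
    congrArg (fun T : EuclideanSpace ℝ (Fin k) →L[ℝ] EuclideanSpace ℝ (Fin k) ↦ T w)
      (W₀.frame_adjoint_graphMap X)
  rwa [h1, h1] at this

theorem isUnit_gram (X : Model k n) :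
    IsUnit ((W₀.graphMap X).adjoint ∘L W₀.graphMap X) := by
  apply isUnit_of_inj
  intro u hu
  have : ⟪W₀.graphMap X u, W₀.graphMap X u⟫_ℝ = 0 := by
    rw [← adjoint_inner_left]
    change ⟪((W₀.graphMap X).adjoint ∘L W₀.graphMap X) u, u⟫_ℝ = 0
    rw [hu, inner_zero_left]
  apply W₀.graphMap_injective X
  rw [map_zero]
  exact inner_self_eq_zero.1 this

/-- The graph of `X`, viewed as a linear map from `W₀` to its orthogonal complement. -/
noncomputable def graph (X : Model k n) : RealGrassmannian k n :=
  ⟨(W₀.graphMap X).range, by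
    rw [LinearMap.finrank_range_of_inj (W₀.graphMap_injective X), finrank_euclideanSpace_fin]⟩

/-- The orthogonal projection onto the graph of `X`: `A (AᵀA)⁻¹ Aᵀ` with `A = graphMap X`. -/
noncomputable def graphProj (X : Model k n) :
    EuclideanSpace ℝ (Fin n) →L[ℝ] EuclideanSpace ℝ (Fin n) :=
  W₀.graphMap X ∘L Ring.inverse ((W₀.graphMap X).adjoint ∘L W₀.graphMap X) ∘L
    (W₀.graphMap X).adjoint

theorem proj_graph (X : Model k n) : (W₀.graph X).proj = W₀.graphProj X :=
  starProjection_range_eq _ (W₀.isUnit_gram X)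

theorem graphMap_adjoint_frame (X : Model k n) :
    (W₀.graphMap X).adjoint ∘L W₀.frame = 1 := by
  have := congrArg adjoint (W₀.frame_adjoint_graphMap X)
  rw [adjoint_comp, adjoint_adjoint] at this
  rw [this]
  exact star_one (EuclideanSpace ℝ (Fin k) →L[ℝ] EuclideanSpace ℝ (Fin k))

theorem compress_graphProj (X : Model k n) :
    W₀.compress (W₀.graphProj X) =
      Ring.inverse ((W₀.graphMap X).adjoint ∘L W₀.graphMap X) := by
  rw [compress, graphProj]
  simp only [comp_assoc]
  rw [graphMap_adjoint_frame, ← comp_assoc, frame_adjoint_graphMap]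
  rfl

theorem coord_graphProj (X : Model k n) : W₀.coord (W₀.graphProj X) = X := by
  have hG := W₀.isUnit_gram X
  rw [coord, compress_graphProj, Ring.inverse_inverse hG, graphProj]
  have h := Ring.inverse_mul_cancel _ hG
  have h1 := W₀.graphMap_adjoint_frame X
  have h2 := W₀.coframe_adjoint_graphMap X
  generalize (W₀.graphMap X).adjoint ∘L W₀.graphMap X = G at h
  ext1 u
  have e (w) : Ring.inverse G (G w) = w := DFunLike.congr_fun h w
  have e1 (w) : (W₀.graphMap X).adjoint (W₀.frame w) = w := DFunLike.congr_fun h1 w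
  have e2 (w) : W₀.coframe.adjoint (W₀.graphMap X w) = X w := DFunLike.congr_fun h2 w
  simp only [comp_apply, e, e1, e2]

theorem graph_coord (hW : IsUnit (W₀.compress W.proj)) : W₀.graph (W₀.coord W.proj) = W := by
  have hA : W₀.graphMap (W₀.coord W.proj) =
      W.proj ∘L W₀.frame ∘L Ring.inverse (W₀.compress W.proj) := by
    have hB : W₀.compress W.proj ∘L Ring.inverse (W₀.compress W.proj) = 1 :=
      Ring.mul_inverse_cancel _ hW
    calc W₀.graphMap (W₀.coord W.proj)
        = W₀.frame ∘L (W₀.compress W.proj ∘L Ring.inverse (W₀.compress W.proj)) +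
          W₀.coframe ∘L W₀.coord W.proj := by rw [hB]; rfl
      _ = (W₀.frame ∘L W₀.frame.adjoint + W₀.coframe ∘L W₀.coframe.adjoint) ∘L
          (W.proj ∘L W₀.frame ∘L Ring.inverse (W₀.compress W.proj)) := by
          rw [add_comp]; rfl
      _ = _ := by rw [frame_add_coframe]; rfl
  apply Subtype.ext
  apply Submodule.eq_of_le_of_finrank_eq
  · rintro _ ⟨u, rfl⟩
    change W₀.graphMap (W₀.coord W.proj) u ∈ W.1
    rw [hA]
    exact Submodule.starProjection_apply_mem _ _
  · rw [(W₀.graph _).2, W.2]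

theorem contDiff_graphProj : ContDiff ℝ ∞ W₀.graphProj := by
  have h1 : ContDiff ℝ ∞ W₀.graphMap := by
    unfold graphMap
    fun_prop
  have h2 : ContDiff ℝ ∞ fun X ↦ (W₀.graphMap X).adjoint := contDiff_adjoint_real.comp h1
  refine h1.clm_comp (ContDiff.clm_comp ?_ h2)
  refine contDiff_iff_contDiffAt.2 fun X ↦ ?_
  obtain ⟨u, hu⟩ := W₀.isUnit_gram X
  have h3 := contDiffAt_ringInverse ℝ (n := ∞) u
  rw [hu] at h3
  exact h3.comp X (h2.clm_comp h1).contDiffAt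

theorem contDiff_compress : ContDiff ℝ ∞ W₀.compress := by
  unfold compress
  fun_prop

theorem contDiffAt_coord {P : EuclideanSpace ℝ (Fin n) →L[ℝ] EuclideanSpace ℝ (Fin n)}
    (hP : IsUnit (W₀.compress P)) : ContDiffAt ℝ ∞ W₀.coord P := by
  obtain ⟨u, hu⟩ := hP
  have h3 := contDiffAt_ringInverse ℝ (n := ∞) u
  rw [hu] at h3
  have h4 : ContDiffAt ℝ ∞ (fun P ↦ Ring.inverse (W₀.compress P)) P :=
    h3.comp P W₀.contDiff_compress.contDiffAt
  unfold coord
  fun_prop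

theorem isOpen_isUnit_compress : IsOpen {P | IsUnit (W₀.compress P)} :=
  Units.isOpen.preimage W₀.contDiff_compress.continuous

/-- The standard affine chart of `Gr(k, n)` at `W₀`, in which the subspace that is the graph of
`X : W₀ → W₀ᗮ` has coordinate `X`. -/
noncomputable def chart : OpenPartialHomeomorph (RealGrassmannian k n) (Model k n) where
  toFun W := W₀.coord W.proj
  invFun := W₀.graph
  source := {W | IsUnit (W₀.compress W.proj)}
  target := Set.univ
  map_source' _ _ := Set.mem_univ _
  map_target' X _ := by
    rw [Set.mem_ofPred_eq, proj_graph, compress_graphProj]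
    exact (W₀.isUnit_gram X).ringInverse
  left_inv' W hW := W₀.graph_coord W hW
  right_inv' X _ := by rw [proj_graph, coord_graphProj]
  open_source := W₀.isOpen_isUnit_compress.preimage continuous_proj
  open_target := isOpen_univ
  continuousOn_toFun W hW :=
    ((W₀.contDiffAt_coord hW).continuousAt.comp continuous_proj.continuousAt).continuousWithinAt
  continuousOn_invFun := by
    refine (continuous_induced_rng.2 ?_).continuousOn
    exact W₀.contDiff_graphProj.continuous.congr fun X ↦ (W₀.proj_graph X).symm

theorem mem_chart_source : W₀ ∈ W₀.chart.source := by
  change IsUnit (W₀.compress W₀.proj)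
  have : W₀.proj ∘L W₀.frame = W₀.frame := by
    ext1 u
    exact Submodule.starProjection_eq_self_iff.2 (W₀.frame_mem u)
  rw [compress, this, frame_adjoint_frame]
  exact isUnit_one

noncomputable instance : ChartedSpace (Model k n) (RealGrassmannian k n) where
  atlas := Set.range chart
  chartAt := chart
  mem_chart_source := mem_chart_source
  chart_mem_atlas W := ⟨W, rfl⟩

instance : IsManifold 𝓘(ℝ, Model k n) ∞ (RealGrassmannian k n) := by
  refine isManifold_of_contDiffOn _ _ _ ?_
  rintro _ _ ⟨W₁, rfl⟩ ⟨W₂, rfl⟩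
  intro X hX
  have hX' : IsUnit (W₂.compress (W₁.graphProj X)) := by
    rw [← proj_graph]
    simpa [chart] using hX
  refine ContDiffAt.contDiffWithinAt ?_
  have h := (W₂.contDiffAt_coord hX').comp X W₁.contDiff_graphProj.contDiffAt
  refine h.congr_of_eventuallyEq ?_
  refine Filter.Eventually.of_forall fun Y ↦ ?_
  change W₂.coord (W₁.graph Y).proj = _
  rw [proj_graph]
  rfl

theorem contMDiff_proj : ContMDiff 𝓘(ℝ, Model k n)
    𝓘(ℝ, EuclideanSpace ℝ (Fin n) →L[ℝ] EuclideanSpace ℝ (Fin n)) ∞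
    (proj : RealGrassmannian k n → _) := by
  rw [contMDiff_iff]
  refine ⟨continuous_proj, fun W Y ↦ ?_⟩
  exact W.contDiff_graphProj.contDiffOn.congr fun X _ ↦ W.proj_graph X

/-- The embedding of `Gr(k, n)` which maps `W` to the matrix of `P_W` divided by `√2`, in the
space of `n × n` matrices with the Frobenius inner product. -/
noncomputable def embedding (W : RealGrassmannian k n) : EuclideanSpace ℝ (Fin n × Fin n) :=
  WithLp.toLp 2 fun p ↦ (√2)⁻¹ * W.proj (EuclideanSpace.single p.2 1) p.1

/-- The linear map sending an operator to its matrix divided by `√2`. -/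
noncomputable def entries (n : ℕ) :
    (EuclideanSpace ℝ (Fin n) →L[ℝ] EuclideanSpace ℝ (Fin n)) →L[ℝ]
      EuclideanSpace ℝ (Fin n × Fin n) :=
  (EuclideanSpace.equiv (Fin n × Fin n) ℝ).symm.toContinuousLinearMap ∘L
    ContinuousLinearMap.pi fun p ↦ (√2)⁻¹ • (EuclideanSpace.proj p.1 ∘L
      ContinuousLinearMap.apply ℝ _ (EuclideanSpace.single p.2 1))

theorem entries_proj : entries n W.proj = W.embedding := rfl

theorem entries_injective : Function.Injective (entries n) := by
  refine (injective_iff_map_eq_zero _).2 fun P hP ↦ ?_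
  have h (j) : P (EuclideanSpace.single j 1) = 0 := by
    ext i
    have := congrArg (fun z : EuclideanSpace ℝ (Fin n × Fin n) ↦ z (i, j)) hP
    simpa [entries] using this
  have := (EuclideanSpace.basisFun (Fin n) ℝ).toBasis.ext (f₁ := P.toLinearMap) (f₂ := 0)
    (by simpa using h)
  exact ContinuousLinearMap.coe_injective this

theorem contMDiff_embedding : ContMDiff 𝓘(ℝ, Model k n)
    𝓘(ℝ, EuclideanSpace ℝ (Fin n × Fin n)) ∞ (embedding : RealGrassmannian k n → _) :=
  (entries n).contMDiff.comp contMDiff_proj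

theorem mvfderiv_embedding_injective (W : RealGrassmannian k n) :
    Function.Injective (mvfderiv 𝓘(ℝ, Model k n) embedding W) := by
  rw [((contMDiff_embedding W).mdifferentiableAt (by simp)).mvfderiv]
  have hw : writtenInExtChartAt 𝓘(ℝ, Model k n) 𝓘(ℝ, EuclideanSpace ℝ (Fin n × Fin n)) W
      embedding = entries n ∘ W.graphProj := by
    funext X
    change entries n (W.graph X).proj = _
    rw [proj_graph]
    rfl
  rw [hw]
  simp only [modelWithCornersSelf_coe, Set.range_id, fderivWithin_univ]
  set X : Model k n := extChartAt 𝓘(ℝ, Model k n) W W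
  have hg : HasFDerivAt W.graphProj (fderiv ℝ W.graphProj X) X :=
    (W.contDiff_graphProj.differentiable (by simp) X).hasFDerivAt
  have hc : HasFDerivAt W.coord (fderiv ℝ W.coord (W.graphProj X)) (W.graphProj X) := by
    refine ((W.contDiffAt_coord ?_).differentiableAt (by simp)).hasFDerivAt
    rw [compress_graphProj]
    exact (W.isUnit_gram X).ringInverse
  have hid : fderiv ℝ W.coord (W.graphProj X) ∘L fderiv ℝ W.graphProj X = .id ℝ _ := by
    refine (hc.comp X hg).unique ?_
    exact (hasFDerivAt_id X).congr_of_eventuallyEq (.of_forall W.coord_graphProj)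
  rw [((entries n).hasFDerivAt.comp X hg).fderiv]
  refine entries_injective.comp (Function.LeftInverse.injective
    (g := fderiv ℝ W.coord (W.graphProj X)) fun u ↦ ?_)
  exact congrArg (fun T : Model k n →L[ℝ] Model k n ↦ T u) hid

set_option synthInstance.maxHeartbeats 200000 in
/-- The canonical metric on `Gr(k, n)`: in the identification of the tangent space at `W` with the
space of linear maps `X : W → Wᗮ`, it is `⟪X, Y⟫ = trace (Xᵀ Y)`. As the differential of
`W ↦ P_W` is `X ↦ X + Xᵀ`, whose squared Frobenius norm is `2 * trace (Xᵀ X)`, this is the metric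
induced by `W ↦ P_W / √2`. -/
noncomputable def canonicalMetric (k n : ℕ) :
    Bundle.ContMDiffRiemannianMetric 𝓘(ℝ, Model k n) ∞ (Model k n)
      (fun W : RealGrassmannian k n ↦ TangentSpace 𝓘(ℝ, Model k n) W) :=
  pullbackMetric embedding contMDiff_embedding mvfderiv_embedding_injective

end RealGrassmannian

/-!
Each of these spaces contains, up to arbitrarily small errors in the distances, the vertices of all
regular `4 n`-gons of a circle of fixed length `2 * L` with its intrinsic metric, and such vertices
rule out every parameter `lam > 0`.

*The circle.* On the vertices of a regular `4 n`-gon the Gram matrix is circulant, and the quadratic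
form of the alternating sign vector is `4 n` times a sum of second differences of
`F t = exp (-lam * t ^ 2)` over `[0, L]` with step `h = L / (2 n)`. This sum is
`h / 2 * (F' L - F' 0) + O(h ^ 2)`, and `F' L < 0 = F' 0`: the kernel is not smooth at the cut
point. So it is negative for large `n` (`exists_sum_secondDiff_neg`,
`not_isPositiveDefiniteKernel_of_circle`).

*Manifolds that are not simply connected.* Let `L` be the infimum of the lengths of the essential
loops; it is positive as small balls contain no essential loops. Divide an essential loop of length
close to `L` into `N` parts of equal length. If two division points were much closer in `M` than
along the loop, a shortcut would produce two loops shorter than `L`, and one of the two is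
essential. This needs no closed geodesics and no limits of curves: it is carried out in
`IsLengthMetric.exists_circle` for length spaces, with loops replaced by chains of short paths,
which remember the homotopy class and the length of the inscribed polygon.

*Spheres and Grassmannians.* The circle is an explicit closed geodesic. Its arcs bound the distance
from above. The lower bound comes from a map `h` to a unit sphere that stretches lengths by at most
a factor `K` and maps the geodesic to a great circle traversed with speed `K`, since the spherical
distance of the ends of a curve on a unit sphere is at most its length
(`angle_le_of_norm_sub_le`, `gaussianRange_pullbackMetric_eq_empty`). For the sphere, `h` is the
inclusion and `K = 1`. For `Gr(k, n)`, `h` sends `W` to the mirror image of a fixed unit vector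
under the reflection in `W`, and `K = 2`: a tangent vector to the set of orthogonal projections has
operator norm at most its Hilbert-Schmidt norm divided by `√2` (`two_mul_norm_sq_apply_le`).
-/

/-! ### Gaussian kernels on a circle -/

section CircleKernel

open Finset Filter Topology

/-- The trapezoidal rule for `∫ F''`, written with second differences: the error is of third order
in the step `h`. -/
theorem abs_secondDiff_sub_le {F F1 F2 F3 : ℝ → ℝ} {C x h : ℝ} (hh : 0 ≤ h)
    (h0 : ∀ t, HasDerivAt F (F1 t) t) (h1 : ∀ t, HasDerivAt F1 (F2 t) t)
    (h2 : ∀ t, HasDerivAt F2 (F3 t) t) (hC : ∀ t ∈ Set.Icc (x - h) (x + h), |F3 t| ≤ C) :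
    |F (x + h) + F (x - h) - 2 * F x - h / 2 * (F1 (x + h) - F1 (x - h))| ≤ C * h ^ 3 := by
  have hp (s : ℝ) {G G' : ℝ → ℝ} (hG : ∀ t, HasDerivAt G (G' t) t) :
      HasDerivAt (fun s ↦ G (x + s)) (G' (x + s)) s := (hG (x + s)).comp_const_add x s
  have hm (s : ℝ) {G G' : ℝ → ℝ} (hG : ∀ t, HasDerivAt G (G' t) t) :
      HasDerivAt (fun s ↦ G (x - s)) (-G' (x - s)) s := by
    simpa using (hG (x - s)).comp_const_sub x s
  have hC0 : 0 ≤ C := (abs_nonneg _).trans (hC x ⟨by linarith, by linarith⟩)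
  have hv : ∀ s ∈ Set.Icc 0 h,
      ‖(F1 (x + s) - F1 (x - s)) - s * (F2 (x + s) + F2 (x - s))‖ ≤ 2 * C * h ^ 2 := by
    intro s hs
    have hd (t : ℝ) : HasDerivAt
        (fun s ↦ (F1 (x + s) - F1 (x - s)) - s * (F2 (x + s) + F2 (x - s)))
        (-t * (F3 (x + t) - F3 (x - t))) t := by
      refine (((hp t h1).sub (hm t h1)).sub
        ((hasDerivAt_id t).mul ((hp t h2).add (hm t h2)))).congr_deriv ?_
      simp only [id, Pi.add_apply]
      ring
    have := norm_image_sub_le_of_norm_deriv_le_segment' (a := 0) (b := h) (C := 2 * C * h)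
      (fun t _ ↦ (hd t).hasDerivWithinAt) (fun t ht ↦ ?_) s hs
    · simp only [add_zero, sub_zero, sub_self, zero_mul] at this
      refine this.trans ?_
      nlinarith [hs.2, mul_nonneg hC0 hh]
    · have e1 := abs_le.1 (hC (x + t) ⟨by linarith [ht.1], by linarith [ht.2]⟩)
      have e2 := abs_le.1 (hC (x - t) ⟨by linarith [ht.2], by linarith [ht.1]⟩)
      have e3 : |F3 (x + t) - F3 (x - t)| ≤ 2 * C := abs_le.2 ⟨by linarith, by linarith⟩
      rw [norm_mul, norm_neg, Real.norm_eq_abs, Real.norm_eq_abs, abs_of_nonneg ht.1]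
      nlinarith [ht.1, ht.2, abs_nonneg (F3 (x + t) - F3 (x - t))]
  have hd (t : ℝ) : HasDerivAt
      (fun s ↦ F (x + s) + F (x - s) - 2 * F x - s / 2 * (F1 (x + s) - F1 (x - s)))
      (((F1 (x + t) - F1 (x - t)) - t * (F2 (x + t) + F2 (x - t))) / 2) t := by
    refine ((((hp t h0).add (hm t h0)).sub_const (2 * F x)).sub
      (((hasDerivAt_id t).div_const 2).mul ((hp t h1).sub (hm t h1)))).congr_deriv ?_
    simp only [id, Pi.sub_apply]
    ring
  have := norm_image_sub_le_of_norm_deriv_le_segment' (a := 0) (b := h) (C := C * h ^ 2)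
    (fun t _ ↦ (hd t).hasDerivWithinAt) (fun t ht ↦ ?_) h ⟨hh, le_rfl⟩
  · simp only [add_zero, sub_zero, sub_self, zero_div, zero_mul, Real.norm_eq_abs] at this
    refine (le_of_eq ?_).trans (this.trans (by ring_nf; rfl))
    congr 1
    ring
  · have := hv t ⟨ht.1, ht.2.le⟩
    rw [norm_div]
    norm_num at this ⊢
    linarith

/-- The alternating trapezoidal sum of a function is a sum of second differences, and so behaves
like `h / 2 * (F' L - F' 0)` for small steps `h`. In particular it is eventually negative if
`F' L < F' 0`. -/
theorem exists_sum_secondDiff_neg {F F1 F2 F3 : ℝ → ℝ} {L : ℝ} (hL : 0 < L)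
    (h0 : ∀ t, HasDerivAt F (F1 t) t) (h1 : ∀ t, HasDerivAt F1 (F2 t) t)
    (h2 : ∀ t, HasDerivAt F2 (F3 t) t) (h3 : Continuous F3) (hneg : F1 L < F1 0) :
    ∃ n : ℕ, 0 < n ∧ ∑ j ∈ range n, (F (L / (2 * n) * (2 * j : ℕ))
      - 2 * F (L / (2 * n) * (2 * j + 1 : ℕ)) + F (L / (2 * n) * (2 * j + 2 : ℕ))) < 0 := by
  obtain ⟨C, hC⟩ := isCompact_Icc.exists_bound_of_continuousOn (s := Set.Icc 0 L) h3.continuousOn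
  obtain ⟨n, hn⟩ := exists_nat_gt (C * L ^ 2 / (2 * (F1 0 - F1 L)))
  have hC0 : 0 ≤ C := (norm_nonneg _).trans (hC 0 ⟨le_rfl, hL.le⟩)
  have hpos : 0 < F1 0 - F1 L := by linarith
  have hn0 : (0 : ℝ) < n := lt_of_le_of_lt (by positivity) hn
  refine ⟨n, by exact_mod_cast hn0, ?_⟩
  set h := L / (2 * n) with hh
  have hhpos : 0 < h := by positivity
  have hnh : 2 * n * h = L := by rw [hh]; field_simp
  have key (j : ℕ) (hj : j ∈ range n) : F (h * (2 * j : ℕ)) - 2 * F (h * (2 * j + 1 : ℕ))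
      + F (h * (2 * j + 2 : ℕ)) ≤
      (h / 2 * F1 (h * (2 * (j + 1) : ℕ)) - h / 2 * F1 (h * (2 * j : ℕ))) + C * h ^ 3 := by
    have hj' : (j : ℝ) + 1 ≤ n := by exact_mod_cast mem_range.1 hj
    have := abs_secondDiff_sub_le (x := h * (2 * j + 1 : ℕ)) (C := C) hhpos.le h0 h1 h2 ?_
    · have e1 : h * (2 * j + 1 : ℕ) + h = h * (2 * j + 2 : ℕ) := by push_cast; ring
      have e2 : h * (2 * j + 1 : ℕ) - h = h * (2 * j : ℕ) := by push_cast; ring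
      rw [e1, e2] at this
      have := (abs_le.1 this).2
      rw [show 2 * (j + 1) = 2 * j + 2 by ring]
      linarith
    · intro t ht
      refine hC t ⟨le_trans ?_ ht.1, ht.2.trans ?_⟩
      · push_cast
        have : 0 ≤ h * (2 * (j : ℝ)) := by positivity
        linarith
      · push_cast
        rw [← hnh]
        nlinarith
  refine lt_of_le_of_lt (sum_le_sum key) ?_
  rw [sum_add_distrib, sum_range_sub (fun j : ℕ ↦ h / 2 * F1 (h * (2 * j : ℕ)))]
  simp only [sum_const, card_range, nsmul_eq_mul]
  have e : h * ((2 * n : ℕ) : ℝ) = L := by push_cast; linarith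
  rw [e]
  simp only [mul_zero, Nat.cast_zero]
  have hn' : C * L ^ 2 < n * (2 * (F1 0 - F1 L)) := by
    rwa [div_lt_iff₀ (by positivity)] at hn
  have e3 : C * L * h < F1 0 - F1 L := by
    have : 2 * n * (C * L * h) = C * L ^ 2 := by rw [← hnh]; ring
    nlinarith
  have : (n : ℝ) * (C * h ^ 3) = h / 2 * (C * L * h) := by rw [← hnh]; ring
  nlinarith [mul_lt_mul_of_pos_left e3 (half_pos hhpos)]

/-- The number of steps between two vertices of a cycle of length `N`, as a function of the
difference of their labels. -/
def cycleDist (N k : ℕ) : ℕ := min (k % N) (N - k % N)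

/-- An alternating sum over a cycle of length `4 * n` folds into a sum of second differences over
half of the cycle. -/
theorem sum_alternating_cycleDist (a : ℕ → ℝ) (n : ℕ) :
    ∑ k ∈ range (4 * n), (-1) ^ k * a (cycleDist (4 * n) k) =
      ∑ j ∈ range n, (a (2 * j) - 2 * a (2 * j + 1) + a (2 * j + 2)) := by
  have h1 : ∑ k ∈ range (4 * n), (-1) ^ k * a (cycleDist (4 * n) k) =
      ∑ k ∈ range (2 * n), ((-1) ^ k * a k + (-1) ^ (k + 1) * a (k + 1)) := by
    rw [show 4 * n = 2 * n + 2 * n by ring, sum_range_add, sum_add_distrib]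
    congr 1
    · refine sum_congr rfl fun k hk ↦ ?_
      have := mem_range.1 hk
      rw [cycleDist, Nat.mod_eq_of_lt (by omega), min_eq_left (by omega)]
    · rw [← sum_range_reflect]
      refine sum_congr rfl fun k hk ↦ ?_
      have := mem_range.1 hk
      rw [cycleDist, Nat.mod_eq_of_lt (by omega), min_eq_right (by omega)]
      congr 1
      · rw [show 2 * n + (2 * n - 1 - k) = 2 * (2 * n - 1 - k) + (k + 1) by omega, pow_add, pow_mul]
        simp
      · congr 1
        omega
  have h2 : ∀ m : ℕ, ∑ k ∈ range (2 * m), ((-1) ^ k * a k + (-1) ^ (k + 1) * a (k + 1)) =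
      ∑ j ∈ range m, (a (2 * j) - 2 * a (2 * j + 1) + a (2 * j + 2)) := by
    intro m
    induction m with
    | zero => simp
    | succ m ih =>
      rw [show 2 * (m + 1) = 2 * m + 1 + 1 by ring, sum_range_succ, sum_range_succ, ih,
        sum_range_succ]
      simp [pow_succ, pow_mul]
      ring
  rw [h1, h2]

theorem sum_range_add_of_periodic {f : ℕ → ℝ} {N : ℕ} (hf : ∀ k, f (k + N) = f k) (c : ℕ) :
    ∑ k ∈ range N, f (k + c) = ∑ k ∈ range N, f k := by
  induction c with
  | zero => rfl
  | succ c ih =>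
    rw [← ih]
    have h1 := sum_range_succ (fun k ↦ f (k + c)) N
    have h2 := sum_range_succ' (fun k ↦ f (k + c)) N
    have h3 := hf c
    simp only [zero_add, add_comm N c] at h1 h2
    rw [h3] at h1
    have : ∑ k ∈ range N, f (k + (c + 1)) = ∑ k ∈ range N, f (k + 1 + c) :=
      sum_congr rfl fun k _ ↦ by congr 1; omega
    rw [this]
    linarith

theorem cycleDist_add_sub {N i j : ℕ} (hij : i ≤ j) (hj : j < N) :
    cycleDist N (j + (N - i)) = min (j - i) (N - (j - i)) ∧
    cycleDist N (i + (N - j)) = min (j - i) (N - (j - i)) := by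
  constructor
  · rw [cycleDist, show j + (N - i) = (j - i) + N by omega, Nat.add_mod_right,
      Nat.mod_eq_of_lt (by omega)]
  · rcases hij.eq_or_lt with rfl | h
    · rw [cycleDist, show i + (N - i) = N by omega, Nat.mod_self]
      simp
    · rw [cycleDist, Nat.mod_eq_of_lt (by omega), min_comm]
      congr 1 <;> omega

/-- If `X` contains, up to arbitrarily small errors in the distances, `4 n` equidistant points of a
circle of length `2 * L` with its intrinsic metric, for every `n`, then no Gaussian kernel is
positive definite on `X`: the alternating sign vector violates positivity. -/
theorem not_isPositiveDefiniteKernel_of_circle {X : Type*} {d : X → X → ℝ} {L lam : ℝ}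
    (hsymm : ∀ x y, d x y = d y x) (hL : 0 < L) (hlam : 0 < lam)
    (hX : ∀ n : ℕ, 0 < n → ∀ ε > 0, ∃ z : ℕ → X, ∀ i j, i ≤ j → j < 4 * n →
      |d (z i) (z j) - L / (2 * n) * (min (j - i) (4 * n - (j - i)) : ℕ)| ≤ ε) :
    ¬ IsPositiveDefiniteKernel fun x y ↦ Real.exp (-lam * d x y ^ 2) := by
  intro hK
  let F : ℝ → ℝ := fun t ↦ Real.exp (-lam * t ^ 2)
  have h0 (t : ℝ) : HasDerivAt F (-(2 * lam) * t * F t) t := by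
    have := (((hasDerivAt_pow 2 t).const_mul (-lam))).exp
    refine this.congr_deriv ?_
    simp only [F]
    push_cast
    ring
  have h1 (t : ℝ) : HasDerivAt (fun t ↦ -(2 * lam) * t * F t)
      ((4 * lam ^ 2 * t ^ 2 - 2 * lam) * F t) t := by
    refine ((((hasDerivAt_id t).const_mul (-(2 * lam))).mul (h0 t))).congr_deriv ?_
    simp only [id]
    ring
  have h2 (t : ℝ) : HasDerivAt (fun t ↦ (4 * lam ^ 2 * t ^ 2 - 2 * lam) * F t)
      (8 * lam ^ 2 * t * F t + (4 * lam ^ 2 * t ^ 2 - 2 * lam) * (-(2 * lam) * t * F t)) t := by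
    refine (((((hasDerivAt_pow 2 t).const_mul (4 * lam ^ 2)).sub_const (2 * lam)).mul
      (h0 t))).congr_deriv ?_
    push_cast
    ring
  have hF : Continuous F := by fun_prop
  obtain ⟨n, hn, hneg⟩ := exists_sum_secondDiff_neg hL h0 h1 h2 (by fun_prop)
    (by
      simp only [mul_zero, zero_mul]
      nlinarith [mul_pos (mul_pos hlam hL) (Real.exp_pos (-lam * L ^ 2))])
  rw [← sum_alternating_cycleDist (fun k ↦ F (L / (2 * n) * k)) n] at hneg
  set D : ℕ → ℝ := fun k ↦ L / (2 * n) * (cycleDist (4 * n) k : ℕ) with hD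
  -- pass to the limit of exactly equidistant points
  choose z hz using fun k : ℕ ↦ hX n hn (1 / ((k : ℝ) + 1)) (by positivity)
  have hlim (i j : ℕ) (hi : i < 4 * n) (hj : j < 4 * n) :
      Tendsto (fun k ↦ d (z k i) (z k j)) atTop (𝓝 (D (j + (4 * n - i)))) := by
    rw [tendsto_iff_dist_tendsto_zero]
    refine squeeze_zero (fun _ ↦ dist_nonneg) (fun k ↦ ?_)
      (tendsto_one_div_add_atTop_nhds_zero_nat (𝕜 := ℝ))
    rw [Real.dist_eq]
    rcases le_total i j with h | h
    · simpa only [hD, (cycleDist_add_sub h hj).1] using hz k i j h hj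
    · rw [hsymm]
      simpa only [hD, (cycleDist_add_sub h hi).2] using hz k j i h hi
  have hsum : Tendsto (fun k ↦ ∑ i ∈ range (4 * n), ∑ j ∈ range (4 * n),
      (-1) ^ i * (-1) ^ j * F (d (z k i) (z k j))) atTop (𝓝 (∑ i ∈ range (4 * n),
        ∑ j ∈ range (4 * n), (-1) ^ i * (-1) ^ j * F (D (j + (4 * n - i))))) := by
    refine tendsto_finsetSum _ fun i hi ↦ tendsto_finsetSum _ fun j hj ↦ ?_
    exact ((hF.tendsto _).comp (hlim i j (mem_range.1 hi) (mem_range.1 hj))).const_mul _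
  have hnn : 0 ≤ ∑ i ∈ range (4 * n),
        ∑ j ∈ range (4 * n), (-1) ^ i * (-1) ^ j * F (D (j + (4 * n - i))) := by
    refine ge_of_tendsto' hsum fun k ↦ ?_
    have := (hK (4 * n) (fun i ↦ z k i)).dotProduct_mulVec_nonneg (fun i ↦ (-1) ^ (i : ℕ))
    simp only [dotProduct, Matrix.mulVec, Matrix.of_apply, Pi.star_apply, star_trivial] at this
    rw [← Fin.sum_univ_eq_sum_range
      (fun i ↦ ∑ j ∈ range (4 * n), (-1) ^ i * (-1) ^ j * F (d (z k i) (z k j)))]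
    refine this.trans_eq (sum_congr rfl fun i _ ↦ ?_)
    rw [mul_sum, ← Fin.sum_univ_eq_sum_range
      (fun j ↦ (-1) ^ (i : ℕ) * (-1) ^ j * F (d (z k i) (z k j)))]
    refine sum_congr rfl fun j _ ↦ ?_
    simp only [F]
    ring
  -- by cyclic symmetry all rows of the Gram matrix contribute the same amount
  have hrow (i : ℕ) (hi : i ∈ range (4 * n)) :
      ∑ j ∈ range (4 * n), (-1) ^ i * (-1) ^ j * F (D (j + (4 * n - i))) =
      ∑ k ∈ range (4 * n), (-1) ^ k * F (D k) := by
    rw [← sum_range_add_of_periodic (f := fun k ↦ (-1) ^ k * F (D k)) (N := 4 * n) ?_ (4 * n - i)]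
    · refine sum_congr rfl fun j _ ↦ ?_
      congr 1
      have hi' := mem_range.1 hi
      have e : (-1 : ℝ) ^ (4 * n - i) = (-1) ^ i := by
        have h4 : (-1 : ℝ) ^ (4 * n - i) * (-1) ^ i = 1 := by
          rw [← pow_add, Nat.sub_add_cancel hi'.le, pow_mul]
          norm_num
        have h5 : (-1 : ℝ) ^ i * (-1) ^ i = 1 := by rw [← mul_pow]; simp
        calc _ = (-1 : ℝ) ^ (4 * n - i) * ((-1) ^ i * (-1) ^ i) := by rw [h5, mul_one]
          _ = _ := by rw [← mul_assoc, h4, one_mul]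
      rw [pow_add, e, mul_comm]
    · intro k
      have e4 : (-1 : ℝ) ^ (4 * n) = 1 := by rw [pow_mul]; norm_num
      simp only [hD, cycleDist, Nat.add_mod_right, pow_add, e4, mul_one]
  rw [sum_congr rfl hrow, sum_const, card_range, nsmul_eq_mul] at hnn
  have : (0 : ℝ) < (4 * n : ℕ) := by exact_mod_cast (by omega : 0 < 4 * n)
  nlinarith [mul_neg_of_pos_of_neg this hneg]

end CircleKernel

/-! ### Curves on the unit sphere -/

section SphericalCurves

open InnerProductGeometry

variable {F : Type*} [NormedAddCommGroup F] [InnerProductSpace ℝ F]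

theorem norm_sub_eq_two_mul_sin_half_angle {x y : F} (hx : ‖x‖ = 1) (hy : ‖y‖ = 1) :
    ‖x - y‖ = 2 * Real.sin (angle x y / 2) := by
  have h0 : 0 ≤ Real.sin (angle x y / 2) :=
    Real.sin_nonneg_of_nonneg_of_le_pi (by linarith [angle_nonneg x y])
      (by linarith [angle_le_pi x y, Real.pi_pos])
  have h1 : ‖x - y‖ ^ 2 = (2 * Real.sin (angle x y / 2)) ^ 2 := by
    have hc : ⟪x, y⟫_ℝ = Real.cos (angle x y) := by
      rw [← cos_angle_mul_norm_mul_norm, hx, hy]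
      ring
    rw [norm_sub_sq_real, hx, hy, hc, mul_pow, Real.sin_sq, Real.cos_sq (angle x y / 2)]
    rw [show 2 * (angle x y / 2) = angle x y by ring]
    ring
  exact (pow_left_inj₀ (norm_nonneg _) (by positivity) two_ne_zero).1 h1

/-- For nearby unit vectors the angle is almost as small as the chord. -/
theorem angle_le_mul_norm_sub {x y : F} {δ : ℝ} (hx : ‖x‖ = 1) (hy : ‖y‖ = 1)
    (hδ : δ ≤ 1) (h : ‖x - y‖ ≤ δ) : angle x y ≤ (1 + δ) * ‖x - y‖ := by
  have hc := norm_sub_eq_two_mul_sin_half_angle hx hy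
  set θ := angle x y
  have hθ0 : 0 ≤ θ := angle_nonneg x y
  have hθπ : θ ≤ Real.pi := angle_le_pi x y
  set c := ‖x - y‖
  have hc0 : 0 ≤ c := norm_nonneg _
  have h1 : 2 / Real.pi * (θ / 2) ≤ Real.sin (θ / 2) := Real.mul_le_sin (by linarith) (by linarith)
  have h2 : θ ≤ 1.6 * c := by
    have h3 : θ ≤ Real.pi / 2 * c := by
      have : 2 / Real.pi * (θ / 2) = θ / Real.pi := by ring
      rw [this, div_le_iff₀ Real.pi_pos] at h1
      rw [hc]
      nlinarith
    nlinarith [Real.pi_lt_d2]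
  -- the chord is `2 * sin (θ / 2)`, which exceeds `θ - θ ^ 3 / 24`
  rcases hθ0.eq_or_lt with h0 | h0
  · rw [← h0]
    nlinarith [norm_nonneg (x - y)]
  · have h4 := Real.sin_gt_sub_cube (x := θ / 2) (by linarith)
    have h5 : θ ^ 3 ≤ (1.6 * c) ^ 3 := pow_le_pow_left₀ hθ0 h2 3
    have h6 : c ^ 3 ≤ δ * c := by
      have : c ^ 2 ≤ δ := by nlinarith
      nlinarith
    nlinarith

/-- The spherical distance between the ends of a curve on the unit sphere is at most its length.
The length enters through any function `V` whose increments dominate the chords of the curve. -/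
theorem angle_le_of_norm_sub_le {σ : ℝ → F} {V : ℝ → ℝ}
    (hσ : ∀ t ∈ Set.Icc (0 : ℝ) 1, ‖σ t‖ = 1) (hcont : ContinuousOn σ (Set.Icc 0 1))
    (hV : ∀ s t, 0 ≤ s → s ≤ t → t ≤ 1 → ‖σ s - σ t‖ ≤ V t - V s) :
    angle (σ 0) (σ 1) ≤ V 1 - V 0 := by
  have key : ∀ δ : ℝ, 0 < δ → δ ≤ 1 → angle (σ 0) (σ 1) ≤ (1 + δ) * (V 1 - V 0) := by
    intro δ hδ hδ1
    obtain ⟨η, hη, H⟩ := Metric.uniformContinuousOn_iff.1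
      (isCompact_Icc.uniformContinuousOn_of_continuous hcont) δ hδ
    obtain ⟨N, hN⟩ := exists_nat_one_div_lt hη
    have hN0 : (0 : ℝ) < N + 1 := by positivity
    have hmem (k : ℕ) (hk : k ≤ N + 1) : (k : ℝ) / (N + 1) ∈ Set.Icc (0 : ℝ) 1 := by
      refine ⟨by positivity, ?_⟩
      rw [div_le_one hN0]
      exact_mod_cast hk
    have ind : ∀ k : ℕ, k ≤ N + 1 →
        angle (σ 0) (σ (k / (N + 1))) ≤ (1 + δ) * (V (k / (N + 1)) - V 0) := by
      intro k
      induction k with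
      | zero =>
        intro _
        have : σ 0 ≠ 0 := norm_ne_zero_iff.1 (by rw [hσ 0 (by simp)]; exact one_ne_zero)
        simp [angle_self this]
      | succ k ih =>
        intro hk
        have hs := hmem k (by omega)
        have ht := hmem (k + 1) hk
        have hst : (k : ℝ) / (N + 1) ≤ ((k + 1 : ℕ) : ℝ) / (N + 1) := by
          push_cast
          gcongr
          linarith
        have hd : ‖σ (k / (N + 1)) - σ ((k + 1 : ℕ) / (N + 1))‖ ≤ δ := by
          rw [← dist_eq_norm]
          refine (H _ hs _ ht ?_).le
          rw [Real.dist_eq, abs_sub_comm, abs_of_nonneg (by linarith)]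
          refine lt_of_eq_of_lt ?_ hN
          push_cast
          ring
        have h1 := angle_le_mul_norm_sub (hσ _ hs) (hσ _ ht) hδ1 hd
        have h2 := hV _ _ hs.1 hst ht.2
        have h3 := angle_le_angle_add_angle (σ 0) (σ (k / (N + 1))) (σ ((k + 1 : ℕ) / (N + 1)))
        have h4 := mul_le_mul_of_nonneg_left h2 (by linarith : 0 ≤ 1 + δ)
        linarith [ih (by omega)]
    have := ind (N + 1) le_rfl
    push_cast at this
    rwa [div_self hN0.ne'] at this
  have hlim : Filter.Tendsto (fun δ : ℝ ↦ (1 + δ) * (V 1 - V 0)) (nhdsWithin 0 (Set.Ioi 0))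
      (nhds ((1 + 0) * (V 1 - V 0))) := by
    refine Filter.Tendsto.mono_left ?_ nhdsWithin_le_nhds
    exact Continuous.tendsto (by fun_prop) 0
  rw [add_zero, one_mul] at hlim
  refine ge_of_tendsto hlim ?_
  filter_upwards [Ioc_mem_nhdsGT (zero_lt_one (α := ℝ))] with δ hδ using key δ hδ.1 hδ.2

end SphericalCurves

/-! ### Chains in length spaces and nearly shortest essential loops -/

section Chains

open Path unitInterval

/-- `Chain δ p c` says that the homotopy class `p` of paths is a concatenation of paths of diameter
less than `δ`, and that the polygon formed by their endpoints has length `c`. -/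
inductive Chain {X : Type*} [PseudoMetricSpace X] (δ : ℝ) {x : X} :
    ∀ {y : X}, Homotopic.Quotient x y → ℝ → Prop
  | nil : Chain δ (Homotopic.Quotient.refl x) 0
  | snoc {y z : X} {p : Homotopic.Quotient x y} {c : ℝ} (γ : Path y z) (h : Chain δ p c)
    (hγ : ∀ s t, dist (γ s) (γ t) < δ) : Chain δ (p.trans (Homotopic.Quotient.mk γ)) (c + dist y z)

variable {X : Type*} [PseudoMetricSpace X]

namespace Chain

variable {δ : ℝ}

theorem single {x y : X} (γ : Path x y) (hγ : ∀ s t, dist (γ s) (γ t) < δ) :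
    Chain δ (Homotopic.Quotient.mk γ) (dist x y) := by
  simpa using (nil (x := x)).snoc γ hγ

theorem comp {x y z : X} {p : Homotopic.Quotient x y} {q : Homotopic.Quotient y z}
    {c c' : ℝ} (hp : Chain δ p c) (hq : Chain δ q c') : Chain δ (p.trans q) (c + c') := by
  induction hq with
  | nil => simpa using hp
  | snoc γ h hγ ih =>
    rw [← Homotopic.Quotient.trans_assoc, ← add_assoc]
    exact ih.snoc γ hγ

theorem symm {x y : X} {p : Homotopic.Quotient x y} {c : ℝ} (hp : Chain δ p c) :
    Chain δ p.symm c := by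
  induction hp with
  | nil =>
    rw [← Homotopic.Quotient.mk_refl, ← Homotopic.Quotient.mk_symm, Path.refl_symm]
    exact nil
  | snoc γ h hγ ih =>
    rename_i y z p c
    have h1 : Chain δ (Homotopic.Quotient.mk γ.symm) (dist z y) := single γ.symm fun s t ↦ hγ _ _
    have h2 := h1.comp ih
    rw [dist_comm, add_comm] at h2
    convert! h2 using 1
    induction p using Homotopic.Quotient.ind with
    | mk a =>
      rw [← Homotopic.Quotient.mk_trans, ← Homotopic.Quotient.mk_symm, Path.trans_symm,
        Homotopic.Quotient.mk_trans, Homotopic.Quotient.mk_symm a]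

theorem mono {δ' : ℝ} (hδ : δ ≤ δ') {x y : X} {p : Homotopic.Quotient x y} {c : ℝ}
    (hp : Chain δ p c) : Chain δ' p c := by
  induction hp with
  | nil => exact nil
  | snoc γ h hγ ih => exact ih.snoc γ fun s t ↦ (hγ s t).trans_le hδ

theorem dist_le {x y : X} {p : Homotopic.Quotient x y} {c : ℝ} (hp : Chain δ p c) :
    dist x y ≤ c := by
  induction hp with
  | nil => simp
  | snoc γ h hγ ih => exact (dist_triangle _ _ _).trans (by linarith)

/-- A chain stays within its length (up to `δ`) of its starting point. -/
theorem exists_path {x y : X} {p : Homotopic.Quotient x y} {c : ℝ} (hp : Chain δ p c)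
    (hδ : 0 < δ) : ∃ γ : Path x y, Homotopic.Quotient.mk γ = p ∧ ∀ t, dist x (γ t) < c + δ := by
  induction hp with
  | nil => exact ⟨Path.refl x, rfl, fun t ↦ by simpa using hδ⟩
  | snoc γ h hγ ih =>
    rename_i y z p c
    obtain ⟨β, rfl, hβ⟩ := ih
    refine ⟨β.trans γ, rfl, fun t ↦ ?_⟩
    have ht : (β.trans γ) t ∈ Set.range (β.trans γ) := ⟨t, rfl⟩
    rw [Path.trans_range] at ht
    rcases ht with ⟨s, hs⟩ | ⟨s, hs⟩
    · rw [← hs]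
      linarith [hβ s, dist_nonneg (x := y) (y := z)]
    · rw [← hs]
      have h1 := hγ 0 s
      rw [γ.source] at h1
      linarith [dist_triangle x y (γ s), h.dist_le, dist_nonneg (x := y) (y := z)]

theorem of_cast {x y x' y' : X} {γ : Path x y} {hx : x' = x} {hy : y' = y} {c : ℝ}
    (h : Chain δ (Homotopic.Quotient.mk (γ.cast hx hy)) c) : Chain δ (Homotopic.Quotient.mk γ) c := by
  subst hx hy
  exact h

/-- Cutting a path into small pieces. The length of the resulting polygon is at most the length of
the path. -/
theorem exists_of_path (hδ : 0 < δ) {x y : X} (γ : Path x y) :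
    ∃ (n : ℕ) (u : ℕ → I), Monotone u ∧
      Chain δ (Homotopic.Quotient.mk γ) (∑ i ∈ Finset.range n, dist (γ (u i)) (γ (u (i + 1)))) := by
  obtain ⟨η, hη, H⟩ := Metric.uniformContinuous_iff.1
    (CompactSpace.uniformContinuous_of_continuous γ.continuous) δ hδ
  obtain ⟨N, hN⟩ := exists_nat_one_div_lt hη
  let u : ℕ → I := fun k ↦ Set.projIcc 0 1 zero_le_one ((k : ℝ) / (N + 1))
  have hN0 : (0 : ℝ) < N + 1 := by positivity
  have hu : Monotone u := fun i j hij ↦ Set.monotone_projIcc _ (by gcongr)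
  have hstep (k : ℕ) (s t : I) :
      dist (γ.subpath (u k) (u (k + 1)) s) (γ.subpath (u k) (u (k + 1)) t) < δ := by
    have hmem (s : I) : ∃ a ∈ Set.Icc (u k) (u (k + 1)), γ a =
        γ.subpath (u k) (u (k + 1)) s := by
      have : γ.subpath (u k) (u (k + 1)) s ∈ Set.range (γ.subpath (u k) (u (k + 1))) := ⟨s, rfl⟩
      rw [Path.range_subpath_of_le _ _ _ (hu k.le_succ)] at this
      exact this
    obtain ⟨a, ha, hae⟩ := hmem s
    obtain ⟨b, hb, hbe⟩ := hmem t
    rw [← hae, ← hbe]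
    refine H ?_
    have hlen : ((u (k + 1) : I) : ℝ) - (u k : I) ≤ 1 / (N + 1) := by
      have h1 := Set.abs_projIcc_sub_projIcc (a := (0 : ℝ)) (b := 1)
        (c := ((k + 1 : ℕ) : ℝ) / (N + 1)) (d := (k : ℝ) / (N + 1)) zero_le_one
      refine (le_abs_self _).trans (h1.trans (le_of_eq ?_))
      rw [abs_of_nonneg] <;> push_cast
      · ring
      · rw [← sub_div]
        simp only [add_sub_cancel_left]
        positivity
    have h1 : ((u k : I) : ℝ) ≤ a := ha.1
    have h2 : (a : ℝ) ≤ u (k + 1) := ha.2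
    have h3 : ((u k : I) : ℝ) ≤ b := hb.1
    have h4 : (b : ℝ) ≤ u (k + 1) := hb.2
    rw [Subtype.dist_eq, Real.dist_eq, abs_lt]
    constructor <;> linarith
  have ind (k : ℕ) : Chain δ (Homotopic.Quotient.mk (γ.subpath (u 0) (u k)))
      (∑ i ∈ Finset.range k, dist (γ (u i)) (γ (u (i + 1)))) := by
    induction k with
    | zero =>
      rw [Path.subpath_self]
      exact nil
    | succ k ih =>
      rw [Finset.sum_range_succ]
      have := ih.snoc (γ.subpath (u k) (u (k + 1))) (hstep k)
      rw [← Homotopic.Quotient.mk_trans] at this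
      rwa [Homotopic.Quotient.eq.2 ⟨Homotopy.subpathTransSubpath γ (u 0) (u k) (u (k + 1))⟩] at this
  refine ⟨N + 1, u, hu, ?_⟩
  have h0 : u 0 = 0 := by simp [u]
  have h1 : u (N + 1) = 1 := by
    simp only [u]
    push_cast
    rw [div_self hN0.ne']
    simp
  have := ind (N + 1)
  rw [h1, h0, Path.subpath_zero_one] at this
  exact this.of_cast

/-- A chain from `x` to `y` can be cut at any prescribed distance from `x` along the chain, up to
errors less than `δ`: `z t` is the cutting point at distance `t`, and `a t`, `b t` are the homotopy
classes of the parts of the chain before and after `z t`. -/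
theorem exists_cut (hδ : 0 < δ) {x y : X} {p : Homotopic.Quotient x y} {c : ℝ}
    (hp : Chain δ p c) : ∃ (z : ℝ → X) (a : ∀ t, Homotopic.Quotient x (z t))
      (b : ∀ t, Homotopic.Quotient (z t) y), (∀ t, (a t).trans (b t) = p) ∧
      (∀ s t, 0 ≤ s → s ≤ t → t ≤ c →
        ∃ c' ≤ t - s + δ, Chain δ ((a s).symm.trans (a t)) c') ∧
      (∀ t, 0 ≤ t → t ≤ c → ∃ c' ≤ t + δ, Chain δ (a t) c') ∧
      (∀ t, 0 ≤ t → t ≤ c → ∃ c' ≤ c - t + δ, Chain δ (b t) c') := by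
  induction hp with
  | nil =>
    refine ⟨fun _ ↦ x, fun _ ↦ .refl x, fun _ ↦ .refl x, fun _ ↦ by simp, ?_, ?_, ?_⟩
    · exact fun s t hs hst ht ↦ ⟨0, by linarith, by
        rw [Homotopic.Quotient.symm_trans]
        exact nil⟩
    · exact fun t ht _ ↦ ⟨0, by linarith, nil⟩
    · exact fun t ht ht' ↦ ⟨0, by linarith, nil⟩
  | snoc γ h hγ ih =>
    rename_i y w p c
    obtain ⟨z, a, b, hab, hst, ha, hb⟩ := ih
    have hyw : dist y w < δ := by simpa using hγ 0 1
    obtain ⟨D, hD1, hD2⟩ : ∃ D : ℝ → Σ z : X, Homotopic.Quotient x z × Homotopic.Quotient z w,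
        (∀ t, t ≤ c → D t = ⟨z t, a t, (b t).trans (.mk γ)⟩) ∧
        (∀ t, ¬ t ≤ c → D t = ⟨y, p, .mk γ⟩) := by
      classical
      exact ⟨fun t ↦ if t ≤ c then ⟨z t, a t, (b t).trans (.mk γ)⟩ else ⟨y, p, .mk γ⟩,
        fun t ht ↦ if_pos ht, fun t ht ↦ if_neg ht⟩
    have hc0 : 0 ≤ c := dist_nonneg.trans h.dist_le
    refine ⟨fun t ↦ (D t).1, fun t ↦ (D t).2.1, fun t ↦ (D t).2.2, fun t ↦ ?_, ?_, ?_, ?_⟩ <;> beta_reduce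
    · by_cases ht : t ≤ c
      · rw [hD1 t ht, ← Homotopic.Quotient.trans_assoc, hab]
      · rw [hD2 t ht]
    · intro s t hs hle htc
      by_cases ht : t ≤ c
      · rw [hD1 t ht, hD1 s (hle.trans ht)]
        exact hst s t hs hle ht
      · rw [hD2 t ht]
        by_cases hsc : s ≤ c
        · rw [hD1 s hsc]
          obtain ⟨c', hc', hch⟩ := hb s hs hsc
          refine ⟨c', by linarith, ?_⟩
          rw [← hab s, ← Homotopic.Quotient.trans_assoc]
          simpa using hch
        · rw [hD2 s hsc]
          exact ⟨0, by linarith, by simpa using nil⟩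
    · intro t ht htc
      by_cases ht' : t ≤ c
      · rw [hD1 t ht']
        exact ha t ht ht'
      · rw [hD2 t ht']
        exact ⟨c, by linarith, h⟩
    · intro t ht htc
      by_cases ht' : t ≤ c
      · rw [hD1 t ht']
        obtain ⟨c', hc', hch⟩ := hb t ht ht'
        exact ⟨c' + dist y w, by linarith, hch.snoc γ hγ⟩
      · rw [hD2 t ht']
        exact ⟨dist y w, by linarith, single γ hγ⟩

end Chain

/-- A pseudometric space is a length space if any two points are joined by paths of length
arbitrarily close to their distance. Lengths are measured by inscribed polygons. -/
def IsLengthMetric (X : Type*) [PseudoMetricSpace X] : Prop :=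
  ∀ x y : X, ∀ η > 0, ∃ γ : Path x y, ∀ (n : ℕ) (u : ℕ → I), Monotone u →
    ∑ i ∈ Finset.range n, dist (γ (u i)) (γ (u (i + 1))) ≤ dist x y + η

namespace IsLengthMetric

theorem exists_chain (hX : IsLengthMetric X) (x y : X) {η δ : ℝ} (hη : 0 < η) (hδ : 0 < δ) :
    ∃ γ : Path x y, (∀ t, dist x (γ t) ≤ dist x y + η) ∧
      ∃ c ≤ dist x y + η, Chain δ (Homotopic.Quotient.mk γ) c := by
  obtain ⟨γ, hγ⟩ := hX x y η hη
  refine ⟨γ, fun t ↦ ?_, ?_⟩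
  · have := hγ 1 (fun i ↦ if i = 0 then 0 else t) (by
      intro i j hij
      rcases eq_or_ne i 0 with rfl | hi
      · simp
      · simp [hi, show j ≠ 0 by omega])
    simpa using this
  · obtain ⟨n, u, hu, h⟩ := Chain.exists_of_path hδ γ
    exact ⟨_, hγ n u hu, h⟩

variable {r : ℝ}

/-- In a length space where small balls contain no essential loops, the pieces of a chain can be
made arbitrarily short without changing the homotopy class and essentially without increasing
the length. -/
theorem refine_chain (hX : IsLengthMetric X)
    (hr : ∀ (x y : X) (β γ : Path x y), (∀ t, dist x (β t) < r) → (∀ t, dist x (γ t) < r) →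
      β.Homotopic γ) {δ₀ δ : ℝ} (hδ₀ : 0 < δ₀) (hδr : 2 * δ₀ ≤ r) (hδ : 0 < δ) {x y : X}
    {p : Homotopic.Quotient x y} {c : ℝ} (hp : Chain δ₀ p c) :
    ∀ η > 0, ∃ c' ≤ c + η, Chain δ p c' := by
  induction hp with
  | nil => exact fun η hη ↦ ⟨0, by linarith, .nil⟩
  | snoc γ h hγ ih =>
    rename_i y z p c
    intro η hη
    obtain ⟨c₁, hc₁, h₁⟩ := ih (η / 2) (by positivity)
    obtain ⟨β, hβ, c₂, hc₂, h₂⟩ := hX.exists_chain y z (η := min (η / 2) (δ₀ / 2)) (by positivity) hδ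
    have hyz : dist y z < δ₀ := by simpa using hγ 0 1
    refine ⟨c₁ + c₂, by linarith [min_le_left (η / 2) (δ₀ / 2)], ?_⟩
    rw [Homotopic.Quotient.eq.2 (hr y z γ β (fun t ↦ ?_) fun t ↦ ?_)]
    · exact h₁.comp h₂
    · have := hγ 0 t
      rw [γ.source] at this
      linarith
    · linarith [hβ t, min_le_right (η / 2) (δ₀ / 2)]

/-- A length space that is not simply connected, but in which small balls contain no essential
loops, contains, up to arbitrarily small errors in the distances, `N` equidistant points of a
circle with its intrinsic metric; its length `L` does not depend on `N`. Such points are found on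
an essential loop whose length is close to the infimum `L` of the lengths of essential loops: if
two of its points were much closer in `X` than along the loop, a shortcut would split it into two
shorter loops, one of which is essential. -/
theorem exists_circle (hX : IsLengthMetric X) (hr0 : 0 < r)
    (hr : ∀ (x y : X) (β γ : Path x y), (∀ t, dist x (β t) < r) → (∀ t, dist x (γ t) < r) →
      β.Homotopic γ)
    {x₀ : X} {p₀ : Homotopic.Quotient x₀ x₀} (hp₀ : p₀ ≠ .refl x₀) :
    ∃ L > 0, ∀ N : ℕ, 0 < N → ∀ ε > 0, ∃ z : ℕ → X, ∀ i j, i ≤ j → j < N →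
      |dist (z i) (z j) - L / N * (min (j - i) (N - (j - i)) : ℕ)| ≤ ε := by
  set δ₀ := r / 2 with hδ₀
  have hδ₀pos : 0 < δ₀ := by positivity
  -- the lengths of the essential loops
  let S : Set ℝ := {c | ∃ (x : X) (p : Homotopic.Quotient x x), p ≠ .refl x ∧ Chain δ₀ p c}
  have hSne : S.Nonempty := by
    induction p₀ using Homotopic.Quotient.ind with
    | mk γ =>
      obtain ⟨n, u, -, h⟩ := Chain.exists_of_path hδ₀pos γ
      exact ⟨_, x₀, _, hp₀, h⟩
  have hSlb : ∀ c ∈ S, δ₀ ≤ c := by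
    rintro c ⟨x, p, hp, hc⟩
    by_contra! hlt
    obtain ⟨γ, rfl, hγ⟩ := hc.exists_path hδ₀pos
    refine hp ?_
    rw [← Homotopic.Quotient.mk_refl]
    exact Homotopic.Quotient.eq.2 (hr x x γ (Path.refl x) (fun t ↦ by linarith [hγ t])
      fun t ↦ by simpa using hr0)
  have hbdd : BddBelow S := ⟨δ₀, hSlb⟩
  set L := sInf S with hL
  have hLpos : 0 < L := hδ₀pos.trans_le (le_csInf hSne hSlb)
  refine ⟨L, hLpos, fun N hN ε hε ↦ ?_⟩
  set η := min (ε / 8) δ₀ with hη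
  have hηpos : 0 < η := by positivity
  have hηε : 8 * η ≤ ε := by linarith [min_le_left (ε / 8) δ₀]
  have hess {x : X} {p : Homotopic.Quotient x x} {c : ℝ} (hp : p ≠ .refl x)
      (hc : Chain η p c) : L ≤ c := csInf_le hbdd ⟨x, p, hp, hc.mono (min_le_right _ _)⟩
  -- a nearly shortest essential loop
  obtain ⟨c₁, ⟨x, p, hp, hc₁⟩, hc₁L⟩ := exists_lt_of_csInf_lt hSne (lt_add_of_pos_right L hηpos)
  obtain ⟨c, hcc₁, hc⟩ := hX.refine_chain hr hδ₀pos (by linarith) hηpos hc₁ η hηpos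
  have hLc : L ≤ c := hess hp hc
  obtain ⟨z, a, b, hab, hst, ha, hb⟩ := hc.exists_cut hηpos
  have hN0 : (0 : ℝ) < N := by exact_mod_cast hN
  refine ⟨fun i ↦ z (L / N * i), fun i j hij hjN ↦ ?_⟩
  set s := L / N * (i : ℝ) with hs
  set t := L / N * (j : ℝ) with ht
  have hs0 : 0 ≤ s := by positivity
  have hsub : L / N * ((j - i : ℕ) : ℝ) = t - s := by
    rw [Nat.cast_sub hij]
    ring
  have hsub' : L / N * ((N - (j - i) : ℕ) : ℝ) = L - (t - s) := by
    rw [Nat.cast_sub (by omega), mul_sub, hsub, div_mul_cancel₀ _ hN0.ne']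
  have hle : s ≤ t := by
    have : (i : ℝ) ≤ j := by exact_mod_cast hij
    exact mul_le_mul_of_nonneg_left this (by positivity)
  have htL : t ≤ L := by
    have : (j : ℝ) ≤ N := by exact_mod_cast hjN.le
    calc t ≤ L / N * N := mul_le_mul_of_nonneg_left this (by positivity)
      _ = L := div_mul_cancel₀ _ hN0.ne'
  rw [Nat.cast_min, mul_min_of_nonneg _ _ (by positivity), hsub, hsub']
  obtain ⟨d₁, hd₁, h₁⟩ := hst s t hs0 hle (htL.trans hLc)
  obtain ⟨d₂, hd₂, h₂⟩ := ha s hs0 (hle.trans (htL.trans hLc))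
  obtain ⟨d₃, hd₃, h₃⟩ := hb t (hs0.trans hle) (htL.trans hLc)
  -- the shortcut
  obtain ⟨γ, -, d₄, hd₄, h₄⟩ := hX.exists_chain (z s) (z t) hηpos hηpos
  have up1 := h₁.dist_le
  have up2 := (h₃.comp h₂).dist_le
  rw [dist_comm] at up2
  have low : t - s ≤ dist (z s) (z t) + 5 * η ∨ L - (t - s) ≤ dist (z s) (z t) + 3 * η := by
    by_contra! hcon
    -- the two loops into which the shortcut divides the given loop are too short to be essential
    have e1 : ((a s).symm.trans (a t)).trans (Homotopic.Quotient.mk γ).symm = .refl (z s) := by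
      by_contra hne
      linarith [hess hne (h₁.comp h₄.symm)]
    have e2 : ((b t).trans (a s)).trans (Homotopic.Quotient.mk γ) = .refl (z t) := by
      by_contra hne
      linarith [hess hne ((h₃.comp h₂).comp h₄)]
    have e3 : (a s).trans (Homotopic.Quotient.mk γ) = a t := by
      calc (a s).trans (Homotopic.Quotient.mk γ)
          = (a s).trans ((((a s).symm.trans (a t)).trans (Homotopic.Quotient.mk γ).symm).trans
              (Homotopic.Quotient.mk γ)) := by
            rw [e1, Homotopic.Quotient.refl_trans]
        _ = a t := by
            rw [Homotopic.Quotient.trans_assoc, Homotopic.Quotient.symm_trans,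
              Homotopic.Quotient.trans_refl, ← Homotopic.Quotient.trans_assoc,
              Homotopic.Quotient.trans_symm, Homotopic.Quotient.refl_trans]
    rw [Homotopic.Quotient.trans_assoc, e3] at e2
    refine hp ?_
    calc p = (a t).trans (((b t).trans (a t)).trans (a t).symm) := by
          rw [Homotopic.Quotient.trans_assoc, Homotopic.Quotient.trans_symm,
            Homotopic.Quotient.trans_refl, hab]
      _ = .refl x := by
          rw [e2, Homotopic.Quotient.refl_trans, Homotopic.Quotient.trans_symm]
  rw [abs_le]
  constructor
  · rcases low with h | h
    · linarith [min_le_left (t - s) (L - (t - s))]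
    · linarith [min_le_right (t - s) (L - (t - s))]
  · rw [sub_le_iff_le_add, ← sub_le_iff_le_add', le_min_iff]
    constructor <;> linarith

end IsLengthMetric
end Chains

/-! ### Manifolds that are not simply connected -/

section SmallBalls

open Path unitInterval

variable {E : Type*} [NormedAddCommGroup E] [NormedSpace ℝ E]

/-- Paths with the same ends are homotopic if they stay in the preimage of a ball under a chart. -/
theorem OpenPartialHomeomorph.homotopic_of_mem_ball {X : Type*} [TopologicalSpace X]
    (φ : OpenPartialHomeomorph X E) {e : E} {ρ : ℝ} (hρ : Metric.ball e ρ ⊆ φ.target) {x y : X}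
    (β γ : Path x y) (hβ : ∀ t, β t ∈ φ.source ∩ φ ⁻¹' Metric.ball e ρ)
    (hγ : ∀ t, γ t ∈ φ.source ∩ φ ⁻¹' Metric.ball e ρ) : β.Homotopic γ := by
  have hx := hβ 0
  have hy := hβ 1
  rw [β.source] at hx
  rw [β.target] at hy
  have : ContractibleSpace (Metric.ball e ρ) :=
    (convex_ball e ρ).contractibleSpace ⟨_, hx.2⟩
  let ψ : C(Metric.ball e ρ, X) :=
    ⟨fun v ↦ φ.symm v, φ.continuousOn_symm.comp_continuous continuous_subtype_val
      fun v ↦ hρ v.2⟩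
  let lift (τ : Path x y) (h : ∀ t, τ t ∈ φ.source ∩ φ ⁻¹' Metric.ball e ρ) :
      Path (⟨φ x, hx.2⟩ : Metric.ball e ρ) ⟨φ y, hy.2⟩ :=
    { toFun := fun t ↦ ⟨φ (τ t), (h t).2⟩
      continuous_toFun := (φ.continuousOn.comp_continuous τ.continuous
        fun t ↦ (h t).1).subtype_mk _
      source' := by simp
      target' := by simp }
  have hlift (τ : Path x y) (h : ∀ t, τ t ∈ φ.source ∩ φ ⁻¹' Metric.ball e ρ) :
      ((lift τ h).map ψ.continuous).cast (φ.left_inv hx.1).symm (φ.left_inv hy.1).symm = τ := by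
    ext t
    exact φ.left_inv (h t).1
  rw [← hlift β hβ, ← hlift γ hγ]
  exact ((SimplyConnectedSpace.paths_homotopic (lift β hβ) (lift γ hγ)).map ψ).pathCast _ _

/-- In a compact manifold, paths in a sufficiently small ball are homotopic as soon as they have the
same ends. -/
theorem exists_radius_homotopic (E : Type*) [NormedAddCommGroup E] [NormedSpace ℝ E]
    (M : Type*) [PseudoMetricSpace M] [CompactSpace M] [ChartedSpace E M] :
    ∃ r > 0, ∀ (x y : M) (β γ : Path x y), (∀ t, dist x (β t) < r) → (∀ t, dist x (γ t) < r) →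
      β.Homotopic γ := by
  have H (x : M) : ∃ ρ > 0, Metric.ball (chartAt E x x) ρ ⊆ (chartAt E x).target :=
    Metric.isOpen_iff.1 (chartAt E x).open_target _ (mem_chart_target E x)
  choose ρ hρ hρt using H
  obtain ⟨r, hr, h⟩ := lebesgue_number_lemma_of_metric (isCompact_univ (X := M))
    (c := fun x ↦ (chartAt E x).source ∩ chartAt E x ⁻¹' Metric.ball (chartAt E x x) (ρ x))
    (fun x ↦ (chartAt E x).isOpen_inter_preimage Metric.isOpen_ball)
    fun x _ ↦ Set.mem_iUnion.2 ⟨x, mem_chart_source E x, Metric.mem_ball_self (hρ x)⟩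
  refine ⟨r, hr, fun x y β γ hβ hγ ↦ ?_⟩
  obtain ⟨i, hi⟩ := h x trivial
  exact (chartAt E i).homotopic_of_mem_ball (hρt i) β γ
    (fun t ↦ hi (Metric.mem_ball'.2 (hβ t))) fun t ↦ hi (Metric.mem_ball'.2 (hγ t))

end SmallBalls

section RiemannianLength

variable {E : Type*} [NormedAddCommGroup E] [NormedSpace ℝ E]
  {H : Type*} [TopologicalSpace H] 

open Bundle in
/-- The Riemannian distance is a length metric: an inscribed polygon of a `C^1` curve is at most as
long as the curve. -/
theorem isLengthMetric_of_isRiemannianManifold (J : ModelWithCorners ℝ E H) {M : Type*}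
    [PseudoMetricSpace M] [ChartedSpace H M] [RiemannianBundle (fun x : M ↦ TangentSpace J x)]
    [IsRiemannianManifold J M] : IsLengthMetric M := by
  intro x y η hη
  have hlt : riemannianEDist J x y < ENNReal.ofReal (dist x y + η) := by
    rw [← IsRiemannianManifold.out (I := J), edist_dist]
    exact (ENNReal.ofReal_lt_ofReal_iff (by positivity)).2 (by linarith)
  obtain ⟨γ, h0, h1, hγ, hlen⟩ := exists_lt_of_riemannianEDist_lt hlt
  let τ : Path x y :=
    { toFun := fun t ↦ γ t
      continuous_toFun := hγ.continuousOn.comp_continuous continuous_subtype_val fun t ↦ t.2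
      source' := by simpa using h0
      target' := by simpa using h1 }
  refine ⟨τ, fun n u hu ↦ ?_⟩
  have hu' (i j : ℕ) (hij : i ≤ j) : ((u i : unitInterval) : ℝ) ≤ u j := hu hij
  have key : ∑ i ∈ Finset.range n, edist (τ (u i)) (τ (u (i + 1))) ≤
      pathELength J γ (u 0) (u n) := by
    induction n with
    | zero => simp
    | succ n ih =>
      rw [Finset.sum_range_succ, ← pathELength_add (hu' 0 n n.zero_le) (hu' n (n + 1) n.le_succ)]
      refine add_le_add ih ?_
      rw [IsRiemannianManifold.out (I := J)]
      exact riemannianEDist_le_pathELength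
        (hγ.mono (Set.Icc_subset_Icc (u n).2.1 (u (n + 1)).2.2)) rfl rfl (hu' _ _ n.le_succ)
  have h2 : ∑ i ∈ Finset.range n, edist (τ (u i)) (τ (u (i + 1))) ≤ ENNReal.ofReal (dist x y + η) :=
    key.trans ((pathELength_mono (u 0).2.1 (u n).2.2).trans hlen.le)
  simp only [edist_dist] at h2
  rw [← ENNReal.ofReal_sum_of_nonneg fun _ _ ↦ dist_nonneg] at h2
  exact (ENNReal.ofReal_le_ofReal_iff (by positivity)).1 h2

theorem edist_ne_top_of_preconnected {X : Type*} [PseudoEMetricSpace X] [PreconnectedSpace X]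
    (x y : X) : edist x y ≠ ⊤ := by
  have h : IsClopen (Metric.eball x ⊤) := ⟨Metric.isClosed_eball_top, Metric.isOpen_eball⟩
  have := h.eq_univ ⟨x, Metric.mem_eball_self (by simp)⟩
  have hy : y ∈ Metric.eball x ⊤ := this ▸ trivial
  exact (Metric.mem_eball'.1 hy).ne

theorem gaussianRange_eq_empty_of_not_simplyConnected {E : Type*} [NormedAddCommGroup E]
    [NormedSpace ℝ E] [FiniteDimensional ℝ E]
    {M : Type*} [TopologicalSpace M] [T2Space M] [CompactSpace M] [ConnectedSpace M]
    [ChartedSpace E M] [IsManifold 𝓘(ℝ, E) ∞ M]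
    (g : Bundle.ContMDiffRiemannianMetric 𝓘(ℝ, E) ∞ E (fun x : M ↦ TangentSpace 𝓘(ℝ, E) x))
    (hM : ¬ SimplyConnectedSpace M) : gaussianRange g = ∅ := by
  let : Bundle.RiemannianBundle (fun x : M ↦ TangentSpace 𝓘(ℝ, E) x) := ⟨g.toRiemannianMetric⟩
  have : IsManifold 𝓘(ℝ, E) 1 M := .of_le (n := ∞) (by simp)
  have : IsContinuousRiemannianBundle E (fun x : M ↦ TangentSpace 𝓘(ℝ, E) x) :=
    ⟨⟨g.inner, g.contMDiff.continuous, fun _ _ _ ↦ rfl⟩⟩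
  let : PseudoEMetricSpace M := .ofRiemannianMetric 𝓘(ℝ, E) M
  let pm : PseudoMetricSpace M := PseudoEMetricSpace.toPseudoMetricSpace edist_ne_top_of_preconnected
  have : IsRiemannianManifold 𝓘(ℝ, E) M := ⟨fun x y ↦ rfl⟩
  have hlen : IsLengthMetric M := isLengthMetric_of_isRiemannianManifold 𝓘(ℝ, E)
  obtain ⟨r, hr0, hr⟩ := exists_radius_homotopic E M
  have : LocallyPathConnectedSpace M := ChartedSpace.locallyPathConnectedSpace E M
  have : PathConnectedSpace M := pathConnectedSpace_iff_connectedSpace.2 inferInstance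
  rw [simply_connected_iff_loops_nullhomotopic] at hM
  push Not at hM
  obtain ⟨x, γ, hγ⟩ := hM inferInstance
  obtain ⟨L, hL, hz⟩ := hlen.exists_circle hr0 hr (p₀ := .mk γ) fun h ↦
    hγ (Path.Homotopic.Quotient.eq.1 h)
  refine Set.eq_empty_of_forall_notMem fun lam ⟨hlam, hK⟩ ↦ ?_
  refine not_isPositiveDefiniteKernel_of_circle (d := riemannianDist g) (L := L / 2)
    (fun x y ↦ dist_comm x y) (by positivity) hlam (fun n hn ε hε ↦ ?_) hK
  obtain ⟨z, hz⟩ := hz (4 * n) (by omega) ε hε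
  refine ⟨z, fun i j hij hj ↦ ?_⟩
  have e : L / 2 / (2 * n) = L / (4 * n : ℕ) := by
    push_cast
    field_simp
    norm_num
  rw [e]
  exact hz i j hij hj

end RiemannianLength

/-! ### Circles in pullback metrics -/

section CirclesInPullbackMetrics

open InnerProductGeometry Bundle

/-- The chain rule for the velocity of a curve. -/
theorem mvfderiv_mfderiv_one {E : Type*} [NormedAddCommGroup E] [NormedSpace ℝ E]
    {H : Type*} [TopologicalSpace H] {I : ModelWithCorners ℝ E H}
    {M : Type*} [TopologicalSpace M] [ChartedSpace H M]
    {F : Type*} [NormedAddCommGroup F] [NormedSpace ℝ F] {f : M → F} {γ : ℝ → M} {v : F} {a : ℝ}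
    (hf : MDifferentiableAt I 𝓘(ℝ, F) f (γ a)) (hγ : MDifferentiableAt 𝓘(ℝ, ℝ) I γ a)
    (hv : HasDerivAt (fun t ↦ f (γ t)) v a) :
    mvfderiv I f (γ a) (mfderiv 𝓘(ℝ, ℝ) I γ a 1) = v := by
  refine (mfderiv_comp_apply a hf hγ 1).symm.trans ?_
  rw [mfderiv_eq_fderiv]
  change fderiv ℝ (fun t ↦ f (γ t)) a (1 : ℝ) = v
  rw [hv.hasFDerivAt.fderiv]
  simp

variable {E : Type*} [NormedAddCommGroup E] [NormedSpace ℝ E] [FiniteDimensional ℝ E]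
  {H : Type*} [TopologicalSpace H] {I : ModelWithCorners ℝ E H}
  {M : Type*} [TopologicalSpace M] [ChartedSpace H M] [IsManifold I ∞ M]
  {F : Type*} [NormedAddCommGroup F] [InnerProductSpace ℝ F]
  {F' : Type*} [NormedAddCommGroup F'] [InnerProductSpace ℝ F']

/-- A unit speed curve bounds the distance of a pullback metric from above; a map `h` to a unit
sphere which stretches lengths at most by the factor `K` bounds it from below. -/
theorem riemannianDist_pullbackMetric_le_and_le {f : M → F} (hf : ContMDiff I 𝓘(ℝ, F) ∞ f)
    (hinj : ∀ x, Function.Injective (mvfderiv I f x)) {γ : ℝ → M}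
    (hγ : ContMDiff 𝓘(ℝ, ℝ) I 1 γ) {v : ℝ → F} (hv : ∀ t, HasDerivAt (fun t ↦ f (γ t)) (v t) t)
    (hv1 : ∀ t, ‖v t‖ ≤ 1) {h : M → F'} (hh : ContMDiff I 𝓘(ℝ, F') 1 h) (hh1 : ∀ x, ‖h x‖ = 1)
    {K : ℝ} (hK : 0 ≤ K) (hfh : ∀ x w, ‖mvfderiv I h x w‖ ≤ K * ‖mvfderiv I f x w‖)
    {s t : ℝ} (hst : s ≤ t) :
    riemannianDist (pullbackMetric f hf hinj) (γ s) (γ t) ≤ t - s ∧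
      angle (h (γ s)) (h (γ t)) ≤ K * riemannianDist (pullbackMetric f hf hinj) (γ s) (γ t) := by
  let : RiemannianBundle (fun x : M ↦ TangentSpace I x) :=
    ⟨(pullbackMetric f hf hinj).toRiemannianMetric⟩
  have hnorm (x : M) (w : TangentSpace I x) : ‖w‖ = ‖mvfderiv I f x w‖ := by
    have h1 : ⟪w, w⟫_ℝ = ⟪mvfderiv I f x w, mvfderiv I f x w⟫_ℝ := rfl
    rw [real_inner_self_eq_norm_sq, real_inner_self_eq_norm_sq] at h1
    exact (pow_left_inj₀ (norm_nonneg _) (norm_nonneg _) two_ne_zero).1 h1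
  have hup : riemannianEDist I (γ s) (γ t) ≤ ENNReal.ofReal (t - s) := by
    refine (riemannianEDist_le_pathELength hγ.contMDiffOn rfl rfl hst).trans ?_
    rw [pathELength_eq_lintegral_mfderiv_Icc]
    have hle (a : ℝ) : ‖mfderiv 𝓘(ℝ, ℝ) I γ a 1‖ₑ ≤ 1 := by
      have hcomp := mvfderiv_mfderiv_one ((hf (γ a)).mdifferentiableAt (by simp))
        ((hγ a).mdifferentiableAt one_ne_zero) (hv a)
      rw [← ofReal_norm, hnorm, hcomp]
      exact ENNReal.ofReal_le_one.2 (hv1 a)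
    calc _ ≤ ∫⁻ a in Set.Icc s t, 1 := MeasureTheory.lintegral_mono hle
      _ = _ := by simp
  have htop : riemannianEDist I (γ s) (γ t) ≠ ⊤ := ne_top_of_le_ne_top ENNReal.ofReal_ne_top hup
  have hd : riemannianDist (pullbackMetric f hf hinj) (γ s) (γ t) =
      (riemannianEDist I (γ s) (γ t)).toReal := rfl
  refine ⟨hd ▸ ENNReal.toReal_le_of_le_ofReal (by linarith) hup, ?_⟩
  rw [hd]
  -- compare with the lengths of nearly shortest curves
  suffices H : ∀ r : ℝ, (riemannianEDist I (γ s) (γ t)).toReal < r →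
      angle (h (γ s)) (h (γ t)) ≤ K * r by
    refine ge_of_tendsto (f := fun r ↦ K * r)
      (x := nhdsWithin _ (Set.Ioi (riemannianEDist I (γ s) (γ t)).toReal))
      (((continuous_const_mul K).tendsto _).mono_left nhdsWithin_le_nhds) ?_
    filter_upwards [self_mem_nhdsWithin] with r hr using H r hr
  intro r hr
  obtain ⟨c, hc0, hc1, hc, hlen⟩ := exists_lt_of_riemannianEDist_lt
    ((ENNReal.lt_ofReal_iff_toReal_lt htop).2 hr)
  have hfin {a b : ℝ} (ha : 0 ≤ a) (hb : b ≤ 1) : pathELength I c a b ≠ ⊤ :=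
    ne_top_of_le_ne_top ENNReal.ofReal_ne_top ((pathELength_mono ha hb).trans hlen.le)
  have hchord (a b : ℝ) (ha : 0 ≤ a) (hab : a ≤ b) (hb : b ≤ 1) :
      ‖h (c a) - h (c b)‖ ≤ K * (pathELength I c 0 b).toReal - K * (pathELength I c 0 a).toReal := by
    have hcab : ContMDiffOn 𝓘(ℝ, ℝ) I 1 c (Set.Icc a b) := hc.mono (Set.Icc_subset_Icc ha hb)
    have h1 : edist (h (c a)) (h (c b)) ≤ pathELength 𝓘(ℝ, F') (h ∘ c) a b := by
      rw [IsRiemannianManifold.out (I := 𝓘(ℝ, F'))]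
      exact riemannianEDist_le_pathELength (hh.comp_contMDiffOn hcab) rfl rfl hab
    have h2 : pathELength 𝓘(ℝ, F') (h ∘ c) a b ≤ ENNReal.ofReal K * pathELength I c a b := by
      rw [pathELength_eq_lintegral_mfderiv_Ioo, pathELength_eq_lintegral_mfderiv_Ioo,
        ← MeasureTheory.lintegral_const_mul' _ _ ENNReal.ofReal_ne_top]
      refine MeasureTheory.setLIntegral_mono' measurableSet_Ioo fun u hu ↦ ?_
      have hcu : MDifferentiableAt 𝓘(ℝ, ℝ) I c u :=
        (hcab.contMDiffAt (Icc_mem_nhds hu.1 hu.2)).mdifferentiableAt one_ne_zero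
      have e : (mfderiv 𝓘(ℝ, ℝ) 𝓘(ℝ, F') (h ∘ c) u 1 : F') =
          mvfderiv I h (c u) (mfderiv 𝓘(ℝ, ℝ) I c u 1) :=
        mfderiv_comp_apply u ((hh (c u)).mdifferentiableAt one_ne_zero) hcu 1
      rw [enorm_tangentSpace_vectorSpace]
      refine (congrArg (fun w : F' ↦ ‖w‖ₑ) e).trans_le ?_
      rw [← ofReal_norm, ← ofReal_norm, ← ENNReal.ofReal_mul hK, hnorm]
      exact ENNReal.ofReal_le_ofReal (hfh (c u) _)
    have h3 : pathELength I c 0 b = pathELength I c 0 a + pathELength I c a b :=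
      (pathELength_add ha hab).symm
    rw [h3, ENNReal.toReal_add (hfin le_rfl (hab.trans hb)) (hfin ha hb), mul_add,
      add_sub_cancel_left, ← dist_eq_norm, dist_edist]
    refine (ENNReal.toReal_mono (ENNReal.mul_ne_top ENNReal.ofReal_ne_top (hfin ha hb))
      (h1.trans h2)).trans_eq ?_
    rw [ENNReal.toReal_mul, ENNReal.toReal_ofReal hK]
  have hangle := angle_le_of_norm_sub_le (σ := h ∘ c)
    (V := fun a ↦ K * (pathELength I c 0 a).toReal) (fun a _ ↦ hh1 _)
    (hh.continuous.comp_continuousOn hc.continuousOn) hchord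
  simp only [Function.comp_apply, hc0, hc1, pathELength_self, ENNReal.toReal_zero, mul_zero,
    sub_zero] at hangle
  refine hangle.trans (mul_le_mul_of_nonneg_left ?_ hK)
  have hr0 : 0 ≤ r := ENNReal.toReal_nonneg.trans hr.le
  exact ENNReal.toReal_le_of_le_ofReal hr0 hlen.le

/-- A pullback metric admits no positive definite Gaussian kernel if the manifold contains a closed
unit speed curve `γ` which a map `h` to a unit sphere, stretching lengths at most by the factor `K`,
sends onto a great circle traversed with speed `K`. -/
theorem gaussianRange_pullbackMetric_eq_empty {f : M → F} (hf : ContMDiff I 𝓘(ℝ, F) ∞ f)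
    (hinj : ∀ x, Function.Injective (mvfderiv I f x)) {γ : ℝ → M}
    (hγ : ContMDiff 𝓘(ℝ, ℝ) I 1 γ) {v : ℝ → F} (hv : ∀ t, HasDerivAt (fun t ↦ f (γ t)) (v t) t)
    (hv1 : ∀ t, ‖v t‖ ≤ 1) {h : M → F'} (hh : ContMDiff I 𝓘(ℝ, F') 1 h) (hh1 : ∀ x, ‖h x‖ = 1)
    {K : ℝ} (hK : 0 < K) (hfh : ∀ x w, ‖mvfderiv I h x w‖ ≤ K * ‖mvfderiv I f x w‖)
    (hper : Function.Periodic γ (2 * (Real.pi / K)))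
    (hcos : ∀ s t, ⟪h (γ s), h (γ t)⟫_ℝ = Real.cos (K * (t - s))) :
    gaussianRange (pullbackMetric f hf hinj) = ∅ := by
  set d := riemannianDist (pullbackMetric f hf hinj) with hd
  have hsymm (x y : M) : d x y = d y x := by
    let : RiemannianBundle (fun x : M ↦ TangentSpace I x) :=
      ⟨(pullbackMetric f hf hinj).toRiemannianMetric⟩
    exact congrArg ENNReal.toReal riemannianEDist_comm
  have main {s t : ℝ} (hst : s ≤ t) := riemannianDist_pullbackMetric_le_and_le hf hinj hγ hv hv1 hh
    hh1 hK.le hfh hst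
  set L := Real.pi / K with hL
  have hLpos : 0 < L := by positivity
  have hKL : K * L = Real.pi := mul_div_cancel₀ _ hK.ne'
  have key (s t : ℝ) (hst : s ≤ t) (htL : t ≤ s + 2 * L) :
      d (γ s) (γ t) = min (t - s) (2 * L - (t - s)) := by
    have up1 := (main hst).1
    have up2 := (main htL).1
    rw [hper s, ← hd, hsymm] at up2
    refine le_antisymm (le_min up1 (by linarith)) ?_
    have low := (main hst).2
    rw [angle, hcos, hh1, hh1, mul_one, div_one] at low
    rcases le_total (t - s) L with h1 | h1
    · rw [Real.arccos_cos (by nlinarith) (by nlinarith)] at low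
      exact (min_le_left _ _).trans (le_of_mul_le_mul_left low hK)
    · have e : Real.cos (K * (t - s)) = Real.cos (K * (2 * L - (t - s))) := by
        rw [← Real.cos_two_pi_sub, ← hKL]
        congr 1
        ring
      rw [e, Real.arccos_cos (by nlinarith) (by nlinarith)] at low
      exact (min_le_right _ _).trans (le_of_mul_le_mul_left low hK)
  refine Set.eq_empty_of_forall_notMem fun lam ⟨hlam, hpd⟩ ↦ ?_
  refine not_isPositiveDefiniteKernel_of_circle (d := d) hsymm hLpos hlam
    (fun n hn ε hε ↦ ⟨fun i ↦ γ (L / (2 * n) * i), fun i j hij hj ↦ ?_⟩) hpd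
  have hn0 : (0 : ℝ) < n := by exact_mod_cast hn
  have hi : (i : ℝ) ≤ j := by exact_mod_cast hij
  have hj' : (j : ℝ) ≤ 4 * n := by exact_mod_cast hj.le
  have hq : 0 < L / (2 * n) := by positivity
  have hqn : L / (2 * n) * (4 * n) = 2 * L := by
    field_simp
    norm_num
  rw [key _ _ (by gcongr) (by nlinarith [mul_nonneg hq.le (Nat.cast_nonneg (α := ℝ) i)])]
  rw [Nat.cast_min, mul_min_of_nonneg _ _ hq.le, Nat.cast_sub hij, Nat.cast_sub (by omega),
    Nat.cast_sub hij]
  push_cast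
  rw [mul_sub (L / (2 * n)) (4 * n), hqn, mul_sub, sub_self, abs_zero]
  exact hε.le

end CirclesInPullbackMetrics

/-! ### Round spheres -/

section GreatCircle

variable {V : Type*} [NormedAddCommGroup V] [InnerProductSpace ℝ V]

theorem inner_cos_smul_add_sin_smul {a b : V} (ha : ‖a‖ = 1) (hb : ‖b‖ = 1) (hab : ⟪a, b⟫_ℝ = 0)
    (s t : ℝ) : ⟪Real.cos s • a + Real.sin s • b, Real.cos t • a + Real.sin t • b⟫_ℝ =
      Real.cos (t - s) := by
  have hba : ⟪b, a⟫_ℝ = 0 := by rw [real_inner_comm, hab]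
  simp only [inner_add_left, inner_add_right, real_inner_smul_left, real_inner_smul_right,
    real_inner_self_eq_norm_sq, ha, hb, hab, hba, Real.cos_sub]
  ring

theorem hasDerivAt_cos_smul_add_sin_smul (a b : V) (t : ℝ) :
    HasDerivAt (fun t ↦ Real.cos t • a + Real.sin t • b)
      (-Real.sin t • a + Real.cos t • b) t :=
  ((Real.hasDerivAt_cos t).smul_const a).add ((Real.hasDerivAt_sin t).smul_const b)

theorem norm_neg_sin_smul_add_cos_smul {a b : V} (ha : ‖a‖ = 1) (hb : ‖b‖ = 1)
    (hab : ⟪a, b⟫_ℝ = 0) (t : ℝ) : ‖-Real.sin t • a + Real.cos t • b‖ = 1 := by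
  have h := inner_cos_smul_add_sin_smul ha hb hab (t + Real.pi / 2) (t + Real.pi / 2)
  rw [sub_self, Real.cos_zero, Real.cos_add_pi_div_two, Real.sin_add_pi_div_two,
    real_inner_self_eq_norm_sq] at h
  exact (pow_eq_one_iff_of_nonneg (norm_nonneg _) two_ne_zero).1 h

theorem gaussianRange_roundMetric_eq_empty {n : ℕ} (hn : 1 ≤ n) :
    gaussianRange (roundMetric n) = ∅ := by
  have : Fact (Module.finrank ℝ (EuclideanSpace ℝ (Fin (n + 1))) = n + 1) := ⟨by simp⟩
  let a : EuclideanSpace ℝ (Fin (n + 1)) := EuclideanSpace.single 0 1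
  let b : EuclideanSpace ℝ (Fin (n + 1)) := EuclideanSpace.single ⟨1, by omega⟩ 1
  have ha : ‖a‖ = 1 := by simp [a]
  have hb : ‖b‖ = 1 := by simp [b]
  have hab : ⟪a, b⟫_ℝ = 0 := by
    simp [a, b, EuclideanSpace.inner_single_left, Fin.ext_iff]
  have hnorm (t : ℝ) : ‖Real.cos t • a + Real.sin t • b‖ = 1 := by
    have h := inner_cos_smul_add_sin_smul ha hb hab t t
    rw [sub_self, Real.cos_zero, real_inner_self_eq_norm_sq] at h
    exact (pow_eq_one_iff_of_nonneg (norm_nonneg _) two_ne_zero).1 h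
  let γ : ℝ → Metric.sphere (0 : EuclideanSpace ℝ (Fin (n + 1))) 1 :=
    fun t ↦ ⟨Real.cos t • a + Real.sin t • b, by simpa using hnorm t⟩
  have hγ : ContMDiff 𝓘(ℝ, ℝ) (𝓡 n) 1 γ := by
    have h1 : ContDiff ℝ 1 fun t : ℝ ↦ Real.cos t • a + Real.sin t • b := by fun_prop
    exact h1.contMDiff.codRestrict_sphere _
  refine gaussianRange_pullbackMetric_eq_empty (K := 1) contMDiff_coe_sphere
    injective_mvfderiv_subtypeVal_sphere hγ
    (fun t ↦ hasDerivAt_cos_smul_add_sin_smul a b t)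
    (fun t ↦ (norm_neg_sin_smul_add_cos_smul ha hb hab t).le) (contMDiff_coe_sphere (m := 1))
    (fun x ↦ by simp) one_pos (fun x w ↦ by rw [one_mul]) (fun t ↦ ?_) fun s t ↦ ?_
  · apply Subtype.ext
    simp [γ]
  · rw [one_mul]
    exact inner_cos_smul_add_sin_smul ha hb hab s t

end GreatCircle

/-! ### Grassmannians -/

section HilbertSchmidt

variable {V : Type*} [NormedAddCommGroup V] [InnerProductSpace ℝ V] {ι : Type*} [Fintype ι]
  (b : OrthonormalBasis ι ℝ V)

/-- The operator norm of `A` is at most the Hilbert-Schmidt norm of its adjoint `B`. -/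
theorem norm_sq_apply_le_sum_adjoint {A B : V → V} (hAB : ∀ x y, ⟪A x, y⟫_ℝ = ⟪x, B y⟫_ℝ) (v : V) :
    ‖A v‖ ^ 2 ≤ (∑ i, ‖B (b i)‖ ^ 2) * ‖v‖ ^ 2 := by
  rw [← b.sum_sq_norm_inner_left (A v), Finset.sum_mul]
  refine Finset.sum_le_sum fun i _ ↦ ?_
  rw [hAB, ← mul_pow, mul_comm]
  exact pow_le_pow_left₀ (norm_nonneg _) (norm_inner_le_norm _ _) 2

theorem sum_norm_sq_adjoint {A B : V → V} (hAB : ∀ x y, ⟪A x, y⟫_ℝ = ⟪x, B y⟫_ℝ) :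
    ∑ i, ‖A (b i)‖ ^ 2 = ∑ i, ‖B (b i)‖ ^ 2 := by
  simp_rw [← b.sum_sq_norm_inner_left (A _), ← b.sum_sq_norm_inner_right (B _)]
  rw [Finset.sum_comm]
  simp_rw [hAB]

/-- Let `Q` be tangent at `P` to the set of orthogonal projections, so that `Q` exchanges the range
and the kernel of `P`. Its operator norm is at most its Hilbert-Schmidt norm divided by `√2`, since
the two blocks of `Q` are adjoint to each other. -/
theorem two_mul_norm_sq_apply_le {P Q : V →L[ℝ] V} (hP : ∀ x y, ⟪P x, y⟫_ℝ = ⟪x, P y⟫_ℝ)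
    (hQ : ∀ x y, ⟪Q x, y⟫_ℝ = ⟪x, Q y⟫_ℝ) (hPP : ∀ x, P (P x) = P x)
    (hPQ : ∀ x, P (Q x) + Q (P x) = Q x) (v : V) :
    2 * ‖Q v‖ ^ 2 ≤ (∑ i, ‖Q (b i)‖ ^ 2) * ‖v‖ ^ 2 := by
  have hPQP (x : V) : P (Q (P x)) = 0 := by
    have := congrArg P (hPQ x)
    rw [map_add, hPP] at this
    simpa using this
  have hadj1 (x y : V) : ⟪P (Q x), y⟫_ℝ = ⟪x, Q (P y)⟫_ℝ := by rw [hP, hQ]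
  have hadj2 (x y : V) : ⟪Q (P x), y⟫_ℝ = ⟪x, P (Q y)⟫_ℝ := by rw [hQ, hP]
  have hsplit (x : V) : ‖Q x‖ ^ 2 = ‖P (Q x)‖ ^ 2 + ‖Q (P x)‖ ^ 2 := by
    have h0 : ⟪P (Q x), Q (P x)⟫_ℝ = 0 := by rw [hP, hPQP, inner_zero_right]
    conv_lhs => rw [← hPQ x]
    rw [norm_add_sq_real, h0]
    ring
  have hv : ‖v‖ ^ 2 = ‖P v‖ ^ 2 + ‖v - P v‖ ^ 2 := by
    have h0 : ⟪P v, v - P v⟫_ℝ = 0 := by rw [hP, map_sub, hPP, sub_self, inner_zero_right]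
    conv_lhs => rw [← add_sub_cancel (P v) v]
    rw [norm_add_sq_real, h0]
    ring
  have hsum : ∑ i, ‖Q (b i)‖ ^ 2 = ∑ i, ‖P (Q (b i))‖ ^ 2 + ∑ i, ‖Q (P (b i))‖ ^ 2 := by
    rw [← Finset.sum_add_distrib]
    exact Finset.sum_congr rfl fun i _ ↦ hsplit (b i)
  have heq := sum_norm_sq_adjoint b (A := fun x ↦ P (Q x)) (B := fun x ↦ Q (P x)) hadj1
  have h1 := norm_sq_apply_le_sum_adjoint b (A := fun x ↦ P (Q x)) (B := fun x ↦ Q (P x)) hadj1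
    (v - P v)
  have h2 := norm_sq_apply_le_sum_adjoint b (A := fun x ↦ Q (P x)) (B := fun x ↦ P (Q x)) hadj2
    (P v)
  simp only [map_sub, hPQP, sub_zero, hPP] at h1 h2 heq
  rw [hsplit, hsum, heq, hv]
  rw [heq] at h2
  linarith

/-- The tangent vectors to curves of orthogonal projections. -/
theorem of_hasDerivAt_projection {P : ℝ → V →L[ℝ] V} {Q : V →L[ℝ] V} {t : ℝ}
    (hP : ∀ t x y, ⟪P t x, y⟫_ℝ = ⟪x, P t y⟫_ℝ) (hPP : ∀ t x, P t (P t x) = P t x)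
    (hQ : HasDerivAt P Q t) :
    (∀ x y, ⟪Q x, y⟫_ℝ = ⟪x, Q y⟫_ℝ) ∧ ∀ x, P t (Q x) + Q (P t x) = Q x := by
  have hQx (x : V) : HasDerivAt (fun t ↦ P t x) (Q x) t := by
    simpa using hQ.clm_apply (hasDerivAt_const t x)
  refine ⟨fun x y ↦ ?_, fun x ↦ ?_⟩
  · have h1 := (hQx x).inner ℝ (hasDerivAt_const t y)
    have h2 := (hasDerivAt_const t x).inner ℝ (hQx y)
    simp only [inner_zero_right, inner_zero_left, zero_add, add_zero] at h1 h2
    simp only [hP] at h1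
    exact h1.unique h2
  · have h1 := hQ.clm_apply (hQx x)
    simp only [hPP] at h1
    rw [add_comm]
    exact h1.unique (hQx x)

end HilbertSchmidt

namespace ContinuousLinearMap

variable {V G : Type*} [NormedAddCommGroup V] [NormedSpace ℝ V] [NormedAddCommGroup G]
  [NormedSpace ℝ G] (B : V →L[ℝ] V →L[ℝ] G) {u : ℝ → V}

theorem hasDerivAt_diagonal {u' : V} {t : ℝ} (hu : HasDerivAt u u' t) :
    HasDerivAt (fun t ↦ B (u t) (u t)) (B u' (u t) + B (u t) u') t :=
  (B.hasFDerivAt.comp_hasDerivAt t hu).clm_apply hu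

theorem contDiff_diagonal (hu : ContDiff ℝ 1 u) : ContDiff ℝ 1 fun t ↦ B (u t) (u t) :=
  (B.contDiff.comp hu).clm_apply hu

end ContinuousLinearMap

namespace RealGrassmannian

variable {k n : ℕ}

/-- Smoothness of a curve in `Gr(k, n)` may be checked on the associated projections. -/
theorem contMDiff_of_contDiff_proj {c : ℝ → RealGrassmannian k n}
    (hc : ContDiff ℝ 1 fun t ↦ (c t).proj) : ContMDiff 𝓘(ℝ, ℝ) 𝓘(ℝ, Model k n) 1 c := by
  intro t
  rw [contMDiffAt_iff_target]
  refine ⟨(continuous_induced_rng.2 hc.continuous).continuousAt, ?_⟩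
  have h1 := (((c t).contDiffAt_coord (c t).mem_chart_source).of_le (m := 1) (by simp)).comp t
    hc.contDiffAt
  exact h1.contMDiffAt

theorem two_mul_norm_entries_sq (T : EuclideanSpace ℝ (Fin n) →L[ℝ] EuclideanSpace ℝ (Fin n)) :
    2 * ‖entries n T‖ ^ 2 = ∑ j, ‖T (EuclideanSpace.basisFun (Fin n) ℝ j)‖ ^ 2 := by
  have h (i j : Fin n) : entries n T (i, j) = (√2)⁻¹ * T (EuclideanSpace.single j 1) i := by
    simp [entries]
  simp_rw [EuclideanSpace.norm_sq_eq, Fintype.sum_prod_type, h, Real.norm_eq_abs, sq_abs, mul_pow]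
  rw [Finset.sum_comm, Finset.mul_sum]
  refine Finset.sum_congr rfl fun j _ ↦ ?_
  rw [Finset.mul_sum]
  refine Finset.sum_congr rfl fun i _ ↦ ?_
  rw [inv_pow, Real.sq_sqrt zero_le_two]
  simp

/-- The image of the vector `v` under the orthogonal reflection in `W`. -/
noncomputable def reflect (v : EuclideanSpace ℝ (Fin n)) (W : RealGrassmannian k n) :
    EuclideanSpace ℝ (Fin n) :=
  (2 : ℝ) • W.proj v - v

theorem norm_reflect (v : EuclideanSpace ℝ (Fin n)) (W : RealGrassmannian k n) :
    ‖reflect v W‖ = ‖v‖ := by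
  rw [← W.1.reflection.norm_map v, Submodule.reflection_apply]
  rw [reflect, proj, two_smul, two_smul]

theorem contMDiff_reflect (v : EuclideanSpace ℝ (Fin n)) : ContMDiff 𝓘(ℝ, Model k n)
    𝓘(ℝ, EuclideanSpace ℝ (Fin n)) ∞ (reflect v : RealGrassmannian k n → _) := by
  have h : ContDiff ℝ ∞ fun T : EuclideanSpace ℝ (Fin n) →L[ℝ] EuclideanSpace ℝ (Fin n) ↦
      (2 : ℝ) • T v - v := by fun_prop
  exact h.contMDiff.comp contMDiff_proj

theorem two_mul_norm_fderiv_graphProj_apply_le {v : EuclideanSpace ℝ (Fin n)} (hv : ‖v‖ = 1)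
    (W : RealGrassmannian k n) (X w : Model k n) :
    ‖(2 : ℝ) • fderiv ℝ W.graphProj X w v‖ ≤ 2 * ‖entries n (fderiv ℝ W.graphProj X w)‖ := by
  have hg : HasFDerivAt W.graphProj (fderiv ℝ W.graphProj X) X :=
    (W.contDiff_graphProj.differentiable (by simp) X).hasFDerivAt
  have hline : HasDerivAt (fun t : ℝ ↦ W.graphProj (X + t • w)) (fderiv ℝ W.graphProj X w) 0 :=
    hg.hasLineDerivAt w
  have hP (Y : Model k n) (x y : EuclideanSpace ℝ (Fin n)) :
      ⟪W.graphProj Y x, y⟫_ℝ = ⟪x, W.graphProj Y y⟫_ℝ := by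
    rw [← proj_graph]
    exact Submodule.inner_starProjection_left_eq_right _ _ _
  have hPP (Y : Model k n) (x : EuclideanSpace ℝ (Fin n)) :
      W.graphProj Y (W.graphProj Y x) = W.graphProj Y x := by
    rw [← proj_graph]
    exact Submodule.starProjection_eq_self_iff.2 (Submodule.starProjection_apply_mem _ _)
  obtain ⟨hQ, hPQ⟩ := of_hasDerivAt_projection (fun t ↦ hP _) (fun t ↦ hPP _) hline
  have key := two_mul_norm_sq_apply_le (EuclideanSpace.basisFun (Fin n) ℝ) (hP _) hQ (hPP _) hPQ v
  rw [← two_mul_norm_entries_sq, hv, one_pow, mul_one] at key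
  rw [norm_smul, Real.norm_ofNat]
  have := (pow_le_pow_iff_left₀ (norm_nonneg _) (norm_nonneg _) two_ne_zero).1
    (le_of_mul_le_mul_left key two_pos)
  linarith

/-- The map `reflect v` stretches lengths at most by the factor `2`. -/
theorem norm_mvfderiv_reflect_le {v : EuclideanSpace ℝ (Fin n)} (hv : ‖v‖ = 1)
    (W : RealGrassmannian k n) (w : TangentSpace 𝓘(ℝ, Model k n) W) :
    ‖mvfderiv 𝓘(ℝ, Model k n) (reflect v) W w‖ ≤
      2 * ‖mvfderiv 𝓘(ℝ, Model k n) embedding W w‖ := by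
  rw [((contMDiff_embedding W).mdifferentiableAt (by simp)).mvfderiv,
    ((contMDiff_reflect v W).mdifferentiableAt (by simp)).mvfderiv]
  let ev : (EuclideanSpace ℝ (Fin n) →L[ℝ] EuclideanSpace ℝ (Fin n)) →L[ℝ]
      EuclideanSpace ℝ (Fin n) := (2 : ℝ) • ContinuousLinearMap.apply ℝ _ v
  have hw : writtenInExtChartAt 𝓘(ℝ, Model k n) 𝓘(ℝ, EuclideanSpace ℝ (Fin n × Fin n)) W
      embedding = entries n ∘ W.graphProj := by
    funext X
    change entries n (W.graph X).proj = _
    rw [proj_graph]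
    rfl
  have hr : writtenInExtChartAt 𝓘(ℝ, Model k n) 𝓘(ℝ, EuclideanSpace ℝ (Fin n)) W
      (reflect v) = fun X ↦ (ev ∘ W.graphProj) X - v := by
    funext X
    change (2 : ℝ) • (W.graph X).proj v - v = _
    rw [proj_graph]
    rfl
  rw [hw, hr]
  simp only [modelWithCornersSelf_coe, Set.range_id, fderivWithin_univ]
  set X : Model k n := extChartAt 𝓘(ℝ, Model k n) W W
  have hg : HasFDerivAt W.graphProj (fderiv ℝ W.graphProj X) X :=
    (W.contDiff_graphProj.differentiable (by simp) X).hasFDerivAt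
  rw [((entries n).hasFDerivAt.comp X hg).fderiv, ((ev.hasFDerivAt.comp X hg).sub_const v).fderiv]
  exact two_mul_norm_fderiv_graphProj_apply_le hv W X w

/-- The subspace spanned by an orthonormal family. -/
noncomputable def ofOrthonormal {v : Fin k → EuclideanSpace ℝ (Fin n)} (hv : Orthonormal ℝ v) :
    RealGrassmannian k n :=
  ⟨Submodule.span ℝ (Set.range v), by
    rw [finrank_span_eq_card hv.linearIndependent, Fintype.card_fin]⟩

/-- The bilinear map sending `x, y` to the rank one operator `v ↦ ⟪x, v⟫ y`. -/
noncomputable def dyad (n : ℕ) : EuclideanSpace ℝ (Fin n) →L[ℝ] EuclideanSpace ℝ (Fin n) →L[ℝ]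
    (EuclideanSpace ℝ (Fin n) →L[ℝ] EuclideanSpace ℝ (Fin n)) :=
  (ContinuousLinearMap.smulRightL ℝ (EuclideanSpace ℝ (Fin n)) (EuclideanSpace ℝ (Fin n))) ∘L
    (innerSL ℝ : EuclideanSpace ℝ (Fin n) →L[ℝ] EuclideanSpace ℝ (Fin n) →L[ℝ] ℝ)

theorem dyad_apply (x y v : EuclideanSpace ℝ (Fin n)) : dyad n x y v = ⟪x, v⟫_ℝ • y := rfl

theorem proj_ofOrthonormal {v : Fin k → EuclideanSpace ℝ (Fin n)} (hv : Orthonormal ℝ v) :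
    (ofOrthonormal hv).proj = ∑ i, dyad n (v i) (v i) := by
  ext1 x
  refine (Submodule.eq_starProjection_of_mem_of_inner_eq_zero ?_ ?_)
  · simp only [sum_apply, dyad_apply]
    exact Submodule.sum_mem _ fun i _ ↦ Submodule.smul_mem _ _ (Submodule.subset_span ⟨i, rfl⟩)
  · intro w hw
    simp only [sum_apply, dyad_apply]
    induction hw using Submodule.span_induction with
    | mem w hw =>
      obtain ⟨j, rfl⟩ := hw
      rw [inner_sub_left, hv.inner_left_fintype, real_inner_comm]
      simp
    | zero => simp
    | add w w' _ _ h h' => rw [inner_add_right, h, h', add_zero]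
    | smul c w _ h => rw [real_inner_smul_right, h, mul_zero]

/-- An orthonormal basis of the subspace at time `t` on a closed geodesic of `Gr(m + 1, n)`: the
first vector rotates in the plane of two coordinate axes, the others are fixed and orthogonal to
that plane. -/
noncomputable def circleBasis {m : ℕ} (h : m + 1 < n) (t : ℝ) :
    Fin (m + 1) → EuclideanSpace ℝ (Fin n) :=
  Fin.cons (Real.cos t • EuclideanSpace.single ⟨0, by omega⟩ (1 : ℝ) +
      Real.sin t • EuclideanSpace.single ⟨m + 1, h⟩ (1 : ℝ))
    fun i ↦ EuclideanSpace.single ⟨i + 1, by omega⟩ 1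

theorem orthonormal_circleBasis {m : ℕ} (h : m + 1 < n) (t : ℝ) :
    Orthonormal ℝ (circleBasis h t) := by
  rw [orthonormal_iff_ite]
  have hab : ⟪(EuclideanSpace.single ⟨0, by omega⟩ (1 : ℝ) : EuclideanSpace ℝ (Fin n)),
      EuclideanSpace.single ⟨m + 1, h⟩ (1 : ℝ)⟫_ℝ = 0 := by
    simp [EuclideanSpace.inner_single_left]
  intro i j
  refine Fin.cases ?_ (fun i ↦ ?_) i <;> refine Fin.cases ?_ (fun j ↦ ?_) j
  · simpa [circleBasis] using inner_cos_smul_add_sin_smul (by simp) (by simp) hab t t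
  · have : (j : ℕ) ≠ m := by omega
    simp [circleBasis, inner_add_left, real_inner_smul_left, EuclideanSpace.inner_single_left,
      Fin.ext_iff, this.symm]
  · have : (i : ℕ) ≠ m := by omega
    simp [circleBasis, inner_add_right, EuclideanSpace.inner_single_left, Fin.ext_iff, this]
  · simp [circleBasis, EuclideanSpace.inner_single_left, Fin.ext_iff]

theorem gaussianRange_canonicalMetric_succ_eq_empty {m : ℕ} (h : m + 1 < n) :
    gaussianRange (canonicalMetric (m + 1) n) = ∅ := by
  let a : EuclideanSpace ℝ (Fin n) := EuclideanSpace.single ⟨0, by omega⟩ 1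
  let b : EuclideanSpace ℝ (Fin n) := EuclideanSpace.single ⟨m + 1, h⟩ 1
  have ha : ‖a‖ = 1 := by simp [a]
  have hb : ‖b‖ = 1 := by simp [b]
  have hab : ⟪a, b⟫_ℝ = 0 := by simp [a, b, EuclideanSpace.inner_single_left]
  let u (t : ℝ) : EuclideanSpace ℝ (Fin n) := Real.cos t • a + Real.sin t • b
  let u' (t : ℝ) : EuclideanSpace ℝ (Fin n) := -Real.sin t • a + Real.cos t • b
  have hu (t : ℝ) : HasDerivAt u (u' t) t := hasDerivAt_cos_smul_add_sin_smul a b t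
  have hu1 (t : ℝ) : ⟪u t, u t⟫_ℝ = 1 := by
    simpa using inner_cos_smul_add_sin_smul ha hb hab t t
  have hu'1 (t : ℝ) : ‖u' t‖ = 1 := norm_neg_sin_smul_add_cos_smul ha hb hab t
  have huu' (t : ℝ) : ⟪u' t, u t⟫_ℝ = 0 := by
    have h1 := ((hu t).inner ℝ (hu t))
    simp only [hu1] at h1
    have h2 := h1.unique (hasDerivAt_const t 1)
    rw [real_inner_comm (u' t) (u t)] at h2
    linarith
  let C : EuclideanSpace ℝ (Fin n) →L[ℝ] EuclideanSpace ℝ (Fin n) :=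
    ∑ i : Fin m, dyad n (EuclideanSpace.single ⟨i + 1, by omega⟩ 1)
      (EuclideanSpace.single ⟨i + 1, by omega⟩ 1)
  let γ (t : ℝ) : RealGrassmannian (m + 1) n := ofOrthonormal (orthonormal_circleBasis h t)
  have hproj (t : ℝ) : (γ t).proj = dyad n (u t) (u t) + C := by
    rw [proj_ofOrthonormal, Fin.sum_univ_succ]
    rfl
  have hCa : C a = 0 := by
    simp [C, a, dyad_apply, EuclideanSpace.inner_single_left]
  have hγ : ContMDiff 𝓘(ℝ, ℝ) 𝓘(ℝ, Model (m + 1) n) 1 γ := by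
    refine contMDiff_of_contDiff_proj ?_
    simp only [hproj]
    have h1 : ContDiff ℝ 1 u := by
      simp only [u]
      fun_prop
    exact ((dyad n).contDiff_diagonal h1).add contDiff_const
  let Q (t : ℝ) := dyad n (u' t) (u t) + dyad n (u t) (u' t)
  have hQ (t : ℝ) : HasDerivAt (fun t ↦ embedding (γ t)) (entries n (Q t)) t := by
    have h1 : HasDerivAt (fun t ↦ (γ t).proj) (Q t) t := by
      simp only [hproj]
      exact ((dyad n).hasDerivAt_diagonal (hu t)).add_const C
    exact (entries n).hasFDerivAt.comp_hasDerivAt t h1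
  have hQ1 (t : ℝ) : ‖entries n (Q t)‖ ≤ 1 := by
    have h1 := two_mul_norm_entries_sq (Q t)
    have h2 (j : Fin n) : ‖Q t (EuclideanSpace.basisFun (Fin n) ℝ j)‖ ^ 2 =
        ‖⟪u' t, EuclideanSpace.basisFun (Fin n) ℝ j⟫_ℝ‖ ^ 2 +
        ‖⟪u t, EuclideanSpace.basisFun (Fin n) ℝ j⟫_ℝ‖ ^ 2 := by
      simp only [Q, add_apply, dyad_apply]
      rw [norm_add_sq_real, real_inner_smul_left, real_inner_smul_right,
        real_inner_comm (u' t) (u t), huu', norm_smul, norm_smul, hu'1, mul_pow, mul_pow,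
        ← real_inner_self_eq_norm_sq (u t), hu1]
      ring
    simp_rw [h2] at h1
    rw [Finset.sum_add_distrib, OrthonormalBasis.sum_sq_norm_inner_left,
      OrthonormalBasis.sum_sq_norm_inner_left, hu'1, ← real_inner_self_eq_norm_sq (u t), hu1] at h1
    nlinarith [norm_nonneg (entries n (Q t))]
  -- the reflections of `a` run through a great circle with speed two
  have hrefl (t : ℝ) : reflect a (γ t) = Real.cos (2 * t) • a + Real.sin (2 * t) • b := by
    have h1 : ⟪u t, a⟫_ℝ = Real.cos t := by
      simp only [u, inner_add_left, real_inner_smul_left, real_inner_self_eq_norm_sq, ha,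
        real_inner_comm a b, hab]
      ring
    rw [reflect, hproj, add_apply, dyad_apply, hCa, h1, Real.cos_two_mul,
      Real.sin_two_mul]
    simp only [u]
    module
  refine gaussianRange_pullbackMetric_eq_empty (K := 2) contMDiff_embedding
    mvfderiv_embedding_injective hγ hQ hQ1 ((contMDiff_reflect a).of_le (by simp))
    (fun W ↦ (norm_reflect a W).trans ha) two_pos (norm_mvfderiv_reflect_le ha) (fun t ↦ ?_)
    fun s t ↦ ?_
  · apply proj_injective
    have : u (t + 2 * (Real.pi / 2)) = -u t := by
      rw [mul_div_cancel₀ _ two_ne_zero]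
      simp only [u, Real.cos_add_pi, Real.sin_add_pi]
      module
    rw [hproj, hproj, this]
    ext1 x
    simp only [add_apply, dyad_apply, inner_neg_left, smul_neg, neg_smul, neg_neg]
  · rw [hrefl, hrefl, inner_cos_smul_add_sin_smul ha hb hab, mul_sub]

end RealGrassmannian

theorem corollary2p2 :
    -- every connected, non-simply-connected closed Riemannian manifold
    (∀ (E : Type u) [NormedAddCommGroup E] [NormedSpace ℝ E] [FiniteDimensional ℝ E]
      (M : Type v) [TopologicalSpace M] [T2Space M] [CompactSpace M] [ConnectedSpace M]
      [ChartedSpace E M] [IsManifold 𝓘(ℝ, E) ∞ M]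
      (g : Bundle.ContMDiffRiemannianMetric 𝓘(ℝ, E) ∞ E
        (fun x : M ↦ TangentSpace 𝓘(ℝ, E) x)),
      ¬ SimplyConnectedSpace M → gaussianRange g = ∅) ∧
    -- the round spheres
    (∀ n : ℕ, 2 ≤ n → gaussianRange (roundMetric n) = ∅) ∧
    -- the real Grassmannians
    (∀ k n : ℕ, 1 ≤ k → k < n → gaussianRange (RealGrassmannian.canonicalMetric k n) = ∅) := by
  refine ⟨fun E _ _ _ M _ _ _ _ _ _ g hM ↦ gaussianRange_eq_empty_of_not_simplyConnected g hM,
    fun n hn ↦ gaussianRange_roundMetric_eq_empty (by omega), fun k n hk hkn ↦ ?_⟩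
  obtain ⟨m, rfl⟩ := Nat.exists_eq_succ_of_ne_zero (Nat.one_le_iff_ne_zero.1 hk)
  exact RealGrassmannian.gaussianRange_canonicalMetric_succ_eq_empty hkn
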